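/- **Setting.** Let $s\in(0,1)$, $n>2s$, let $\Omega\subset\mathbb R^n$ be a bounded open set with continuous boundary, and let $K:\mathbb R^n\setminus\{0\}\to(0,+\infty)$ satisfy $\min\{|x|^2,1\}\,K\in L^1(\mathbb R^n)$ and, for some $\theta>0$, $K(x)\ge\theta|x|^{-(n+2s)}$ for all $x\neq0$. Let $X_0$ be the space of (a.e. classes of) measurable $g:\mathbb R^n\to\mathbb R$ with $g|_\Omega\in L^2(\Omega)$, $(x,y)\mapsto(g(x)-g(y))\sqrt{K(x-y)}$ in $L^2\big(\mathbb R^n\times\mathbb R^n\setminus((\mathbb R^n\setminus\Omega)\times(\mathbb R^n\setminus\Omega))\big)$, and $g=0$ a.e. in $\mathbb R^n\setminus\Omega$; it is a Hilbert space with $$\langle u,v\rangle_{X_0}=\int_{\mathbb R^n\times\mathbb R^n}(u(x)-u(y))(v(x)-v(y))K(x-y)\,dx\,dy .$$ Let $f:\Omega\times\mathbb R\to\mathbb R$ be a Carathéodory function, $F(x,t)=\int_0^tf(x,\tau)\,d\tau$, and suppose that for some $q\in(2,\tfrac{2n}{n-2s})$ and some constants $a_1,a_2,a_3,a_4>0$,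 for a.e. $x\in\Omega$: $|f(x,t)|\le a_1+a_2|t|^{q-1}$ and $F(x,t)\ge a_3|t|^q-a_4$ for all $t\in\mathbb R$, and $0<qF(x,t)\le tf(x,t)$ for all $t\ne0$; suppose moreover that $f(x,t)/|t|\to0$ as $|t|\to0$, uniformly in $x\in\Omega$. For $\lambda\in\mathbb R$ let $$\mathcal J_\lambda(u)=\tfrac12\int_{\mathbb R^n\times\mathbb R^n}|u(x)-u(y)|^2K(x-y)\,dx\,dy-\tfrac\lambda2\int_\Omega|u|^2\,dx-\int_\Omega F(x,u(x))\,dx,\qquad u\in X_0,$$ with gradient $\nabla\mathcal J_\lambda(u)\in X_0$ taken with respect to $\langle\cdot,\cdot\rangle_{X_0}$. Let $\lambda_1\le\lambda_2\le\dots$ be all the eigenvalues, repeated according to multiplicity, of the weak problem $u\in X_0$, $\langle u,\varphi\rangle_{X_0}=\lambda\int_\Omega u\varphi\,dx$ for all $\varphi\in X_0$, with corresponding eigenfunctions $e_1,e_2,\dots$ orthonormal in $L^2(\Omega)$. Put $\mathbb H_j=\mathrm{span}\{e_1,\dots,e_j\}$ and $\mathbb P_j=\{u\in X_0:\langle u,e_i\rangle_{X_0}=0,\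 i=1,\dots,j\}$. For a closed subspace $C\subseteq X_0$ with orthogonal projection $P_C$, and $a,b\in\mathbb R\cup\{\pm\infty\}$, condition $(\nabla)(\mathcal J_\lambda,C,a,b)$ means: there is $\gamma>0$ such that $$\inf\big\{\|P_C\nabla\mathcal J_\lambda(u)\|_{X_0}:\ u\in X_0,\ a\le\mathcal J_\lambda(u)\le b,\ \mathrm{dist}(u,C)\le\gamma\big\}>0\qquad(\inf\emptyset=+\infty).$$ **Proposition.** Let $k\ge2$ and $m\ge1$ be integers with $\lambda_{k-1}<\lambda_k=\dots=\lambda_{k+m-1}<\lambda_{k+m}$. Then for every $\sigma>0$ there is $\varepsilon_\sigma>0$ such that for every $\lambda\in[\lambda_{k-1}+\sigma,\lambda_{k+m}-\sigma]$ and all $\varepsilon',\varepsilon''$ with $0<\varepsilon'<\varepsilon''<\varepsilon_\sigma$, the condition $(\nabla)(\mathcal J_\lambda,\mathbb H_{k-1}\oplus\mathbb P_{k+m-1},\varepsilon',\varepsilon'')$ holds. -/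

import Mathlib

open MeasureTheory Filter Topology

noncomputable section

/-- `Ω` has continuous boundary: near each boundary point, in suitable rigid coordinates with
vertical direction `ν`, the set `Ω` is the (strict) subgraph of a continuous function `g` of the
remaining coordinates. -/
def HasContinuousBoundary {n : ℕ} (Ω : Set (EuclideanSpace ℝ (Fin n))) : Prop :=
  ∀ x₀ ∈ frontier Ω, ∃ (ν : EuclideanSpace ℝ (Fin n)) (r : ℝ) (g : (ℝ ∙ ν)ᗮ → ℝ),
    ‖ν‖ = 1 ∧ 0 < r ∧ Continuous g ∧
      ∀ x ∈ Metric.ball x₀ r,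
        (x ∈ Ω ↔ inner ℝ ν x < g ((ℝ ∙ ν)ᗮ.orthogonalProjectionOnto x))

/-- The data `s ∈ (0,1)`, `n > 2s`, a bounded open set `Ω ⊆ ℝⁿ` with continuous boundary, and a
kernel `K : ℝⁿ ∖ {0} → (0,∞)` with `min (|x|²) 1 * K ∈ L¹(ℝⁿ)` and `K x ≥ θ |x|^{-(n+2s)}` for some
`θ > 0`.  (The value `K 0` is irrelevant.) -/
structure NonlocalSetting where
  n : ℕ
  s : ℝ
  Ω : Set (EuclideanSpace ℝ (Fin n))
  K : EuclideanSpace ℝ (Fin n) → ℝ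
  s_pos : 0 < s
  s_lt_one : s < 1
  two_s_lt : 2 * s < n
  isOpen_Ω : IsOpen Ω
  isBounded_Ω : Bornology.IsBounded Ω
  boundary_Ω : HasContinuousBoundary Ω
  K_pos : ∀ x, x ≠ 0 → 0 < K x
  K_integrable : Integrable (fun x => min (‖x‖ ^ 2) 1 * K x) volume
  K_lower : ∃ θ : ℝ, 0 < θ ∧ ∀ x, x ≠ 0 → θ * ‖x‖ ^ (-((n : ℝ) + 2 * s)) ≤ K x

namespace NonlocalSetting

/-- The ambient space `ℝⁿ`. -/
abbrev E (S : NonlocalSetting) : Type := EuclideanSpace ℝ (Fin S.n)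

/-- The function `(x, y) ↦ (g x - g y) √K(x - y)`. -/
def diffq (S : NonlocalSetting) (g : S.E → ℝ) (p : S.E × S.E) : ℝ :=
  (g p.1 - g p.2) * √(S.K (p.1 - p.2))

variable (S : NonlocalSetting)

lemma diffq_add_ae (g h : S.E →ₘ[volume] ℝ) :
    S.diffq (g + h : S.E →ₘ[volume] ℝ) =ᵐ[volume] S.diffq g + S.diffq h := by
  have H := AEEqFun.coeFn_add g h
  have h1 := (Measure.quasiMeasurePreserving_fst (μ := (volume : Measure S.E))
    (ν := (volume : Measure S.E))).ae_eq_comp H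
  have h2 := (Measure.quasiMeasurePreserving_snd (μ := (volume : Measure S.E))
    (ν := (volume : Measure S.E))).ae_eq_comp H
  rw [Measure.volume_eq_prod]
  filter_upwards [h1, h2] with p e1 e2
  simp only [Function.comp, Pi.add_apply] at e1 e2
  simp only [diffq, Pi.add_apply, e1, e2]
  ring

lemma diffq_smul_ae (c : ℝ) (g : S.E →ₘ[volume] ℝ) :
    S.diffq (c • g : S.E →ₘ[volume] ℝ) =ᵐ[volume] c • S.diffq g := by
  have H := AEEqFun.coeFn_smul c g
  have h1 := (Measure.quasiMeasurePreserving_fst (μ := (volume : Measure S.E))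
    (ν := (volume : Measure S.E))).ae_eq_comp H
  have h2 := (Measure.quasiMeasurePreserving_snd (μ := (volume : Measure S.E))
    (ν := (volume : Measure S.E))).ae_eq_comp H
  rw [Measure.volume_eq_prod]
  filter_upwards [h1, h2] with p e1 e2
  simp only [Function.comp, Pi.smul_apply, smul_eq_mul] at e1 e2
  simp only [diffq, Pi.smul_apply, smul_eq_mul, e1, e2]
  ring

/-- The region `ℝⁿ × ℝⁿ ∖ (∁Ω × ∁Ω)`. -/
def crossRegion : Set (S.E × S.E) := (S.Ωᶜ ×ˢ S.Ωᶜ)ᶜ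

/-- The linear space `X₀`, as a space of classes of measurable functions modulo equality almost
everywhere: `g` is in `L²(Ω)`, the map `(x, y) ↦ (g x - g y) √K(x - y)` is in
`L²(ℝⁿ × ℝⁿ ∖ (∁Ω × ∁Ω))`, and `g = 0` almost everywhere outside `Ω`. -/
def X0Submodule : Submodule ℝ (S.E →ₘ[volume] ℝ) where
  carrier := {g | MemLp g 2 (volume.restrict S.Ω) ∧
    MemLp (S.diffq g) 2 (volume.restrict S.crossRegion) ∧
    ∀ᵐ x ∂(volume.restrict S.Ωᶜ), g x = 0}
  zero_mem' := by
    have H : ((0 : S.E →ₘ[volume] ℝ) : S.E → ℝ) =ᵐ[volume] 0 := AEEqFun.coeFn_zero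
    have h1 := (Measure.quasiMeasurePreserving_fst (μ := (volume : Measure S.E))
      (ν := (volume : Measure S.E))).ae_eq_comp H
    have h2 := (Measure.quasiMeasurePreserving_snd (μ := (volume : Measure S.E))
      (ν := (volume : Measure S.E))).ae_eq_comp H
    refine ⟨(memLp_congr_ae (ae_restrict_of_ae H)).2 MemLp.zero, ?_, ae_restrict_of_ae H⟩
    have h3 : S.diffq (0 : S.E →ₘ[volume] ℝ) =ᵐ[volume] 0 := by
      rw [Measure.volume_eq_prod]
      filter_upwards [h1, h2] with p e1 e2
      simp only [Function.comp, Pi.zero_apply] at e1 e2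
      simp [diffq, e1, e2]
    exact (memLp_congr_ae (ae_restrict_of_ae h3)).2 MemLp.zero
  add_mem' := by
    rintro g h ⟨g1, g2, g3⟩ ⟨h1, h2, h3⟩
    refine ⟨(memLp_congr_ae (ae_restrict_of_ae (AEEqFun.coeFn_add g h))).2 (g1.add h1),
      (memLp_congr_ae (ae_restrict_of_ae (S.diffq_add_ae g h))).2 (g2.add h2), ?_⟩
    filter_upwards [g3, h3, ae_restrict_of_ae (AEEqFun.coeFn_add g h)] with x a b c
    simp [c, a, b]
  smul_mem' := by
    rintro c g ⟨g1, g2, g3⟩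
    refine ⟨(memLp_congr_ae (ae_restrict_of_ae (AEEqFun.coeFn_smul c g))).2 (g1.const_smul c),
      (memLp_congr_ae (ae_restrict_of_ae (S.diffq_smul_ae c g))).2 (g2.const_smul c), ?_⟩
    filter_upwards [g3, ae_restrict_of_ae (AEEqFun.coeFn_smul c g)] with x a b
    simp [b, a]

/-- The space `X₀`; its norm and inner product are introduced below. -/
def X0 : Type := S.X0Submodule

instance : AddCommGroup S.X0 := inferInstanceAs (AddCommGroup S.X0Submodule)
instance : Module ℝ S.X0 := inferInstanceAs (Module ℝ S.X0Submodule)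

variable {S}

/-- A representative, defined on all of `ℝⁿ`, of an element of `X₀`. -/
def X0.fn (u : S.X0) : S.E → ℝ := (u.1 : S.E →ₘ[volume] ℝ)

instance : CoeFun S.X0 (fun _ => S.E → ℝ) := ⟨X0.fn⟩

lemma X0.memLp_restrict (u : S.X0) : MemLp u 2 (volume.restrict S.Ω) := u.2.1

lemma X0.ae_eq_zero (u : S.X0) : ∀ᵐ x, x ∉ S.Ω → u x = 0 :=
  (ae_restrict_iff' S.isOpen_Ω.measurableSet.compl).1 u.2.2.2

lemma X0.memLp (u : S.X0) : MemLp u 2 volume := by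
  refine (memLp_congr_ae ?_).1 ((memLp_indicator_iff_restrict S.isOpen_Ω.measurableSet).2
    u.memLp_restrict)
  filter_upwards [u.ae_eq_zero] with x hx
  by_cases h : x ∈ S.Ω
  · simp [h]
  · simp [h, hx h]

lemma X0.memLp_diffq (u : S.X0) : MemLp (S.diffq u) 2 volume := by
  have hm : MeasurableSet S.crossRegion :=
    (S.isOpen_Ω.measurableSet.compl.prod S.isOpen_Ω.measurableSet.compl).compl
  have h0 : MemLp (S.diffq u) 2 (volume.restrict S.crossRegion) := u.2.2.1
  refine (memLp_congr_ae ?_).1 ((memLp_indicator_iff_restrict hm).2 h0)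
  have h1 := (Measure.quasiMeasurePreserving_fst (μ := (volume : Measure S.E))
    (ν := (volume : Measure S.E))).ae u.ae_eq_zero
  have h2 := (Measure.quasiMeasurePreserving_snd (μ := (volume : Measure S.E))
    (ν := (volume : Measure S.E))).ae u.ae_eq_zero
  rw [Measure.volume_eq_prod]
  filter_upwards [h1, h2] with p e1 e2
  by_cases h : p ∈ S.crossRegion
  · simp [h]
  · have h' : p.1 ∉ S.Ω ∧ p.2 ∉ S.Ω := by
      simpa [crossRegion] using h
    simp [h, diffq, e1 h'.1, e2 h'.2]

variable (S)

/-- The linear map `u ↦ (u x - u y) √K(x - y)` from `X₀` to `L²(ℝⁿ × ℝⁿ)`. -/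
def toL2 : S.X0 →ₗ[ℝ] Lp ℝ 2 (volume : Measure (S.E × S.E)) where
  toFun u := u.memLp_diffq.toLp
  map_add' u v := by
    rw [← MemLp.toLp_add]
    exact MemLp.toLp_congr _ _ (S.diffq_add_ae u.1 v.1)
  map_smul' c u := by
    rw [RingHom.id_apply, ← MemLp.toLp_const_smul]
    exact MemLp.toLp_congr _ _ (S.diffq_smul_ae c u.1)

variable {S}

/-- The inner product
`⟨u, v⟩ = ∬ (u x - u y) (v x - v y) K(x - y) dx dy` of `X₀`. -/
instance : Inner ℝ S.X0 :=
  ⟨fun u v => ∫ p : S.E × S.E, (u p.1 - u p.2) * (v p.1 - v p.2) * S.K (p.1 - p.2)⟩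

lemma X0.inner_def (u v : S.X0) :
    inner ℝ u v =
      ∫ p : S.E × S.E, (u p.1 - u p.2) * (v p.1 - v p.2) * S.K (p.1 - p.2) := rfl

lemma X0.inner_eq (u v : S.X0) : inner ℝ u v = inner ℝ (S.toL2 u) (S.toL2 v) := by
  rw [X0.inner_def, L2.inner_def]
  refine integral_congr_ae ?_
  filter_upwards [u.memLp_diffq.coeFn_toLp, v.memLp_diffq.coeFn_toLp] with p e1 e2
  have e1' : (S.toL2 u) p = S.diffq u p := e1
  have e2' : (S.toL2 v) p = S.diffq v p := e2
  rw [e1', e2']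
  simp only [diffq, RCLike.inner_apply, conj_trivial]
  by_cases h : p.1 - p.2 = 0
  · rw [sub_eq_zero] at h
    simp [h]
  · have := Real.mul_self_sqrt (S.K_pos _ h).le
    linear_combination -(u p.1 - u p.2) * (v p.1 - v p.2) * this

/-- The Poincaré inequality in `X₀`, needed for definiteness and completeness of the norm. -/
lemma exists_poincare (S : NonlocalSetting) : ∃ C : NNReal, ∀ u : S.X0,
    eLpNorm u 2 volume ≤ C * eLpNorm (S.diffq u) 2 volume := by
  obtain ⟨R, hR0, hR⟩ := S.isBounded_Ω.subset_closedBall_lt 0 0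
  obtain ⟨θ, hθ, hK⟩ := S.K_lower
  have hn : 0 < S.n := by
    have h1 := S.s_pos
    have h2 := S.two_s_lt
    have : (0 : ℝ) < S.n := by linarith
    exact_mod_cast this
  have : Nonempty (Fin S.n) := ⟨⟨0, hn⟩⟩
  obtain ⟨z, hz⟩ := exists_norm_eq S.E (show (0 : ℝ) ≤ R + 2 by linarith)
  set α : ℝ := (S.n : ℝ) + 2 * S.s with hα
  have hαpos : 0 < α := by
    have := S.s_pos
    positivity
  set c : ℝ := θ * (2 * R + 3) ^ (-α) with hc
  have hcpos : 0 < c := by positivity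
  set B : Set S.E := Metric.ball z 1 with hB
  set k : ENNReal := ENNReal.ofReal c * volume B with hk
  have hk0 : k ≠ 0 := by
    refine mul_ne_zero (by simpa using hcpos) ?_
    exact (Metric.measure_ball_pos volume z one_pos).ne'
  have hkt : k ≠ ⊤ := ENNReal.mul_ne_top ENNReal.ofReal_ne_top measure_ball_lt_top.ne
  have hgeo : ∀ x ∈ S.Ω, ∀ y ∈ B, y ∉ S.Ω ∧ c ≤ S.K (x - y) := by
    intro x hx y hy
    have hx' : ‖x‖ ≤ R := by simpa using hR hx
    have hy' : ‖y - z‖ < 1 := by simpa [hB, dist_eq_norm] using hy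
    have h1 : ‖z‖ ≤ ‖y‖ + ‖y - z‖ := by
      have := norm_sub_le y (y - z)
      simpa using this
    have h2 : ‖y‖ ≤ ‖z‖ + ‖y - z‖ := by
      have := norm_add_le z (y - z)
      simpa using this
    have h3 : y ∉ S.Ω := fun h => by
      have : ‖y‖ ≤ R := by simpa using hR h
      linarith
    have hne : x - y ≠ 0 := fun h => h3 (by rwa [sub_eq_zero.1 h] at hx)
    refine ⟨h3, le_trans ?_ (hK _ hne)⟩
    have h4 : ‖x - y‖ ≤ 2 * R + 3 := by
      have := norm_sub_le x y
      linarith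
    have h5 := Real.rpow_le_rpow_of_nonpos (norm_pos_iff.2 hne) h4 (neg_nonpos.2 hαpos.le)
    exact mul_le_mul_of_nonneg_left h5 hθ.le
  refine ⟨((k⁻¹) ^ (1 / 2 : ℝ)).toNNReal, fun u => ?_⟩
  have hCt : (k⁻¹) ^ (1 / 2 : ℝ) ≠ ⊤ :=
    ENNReal.rpow_ne_top_of_nonneg (by norm_num) (ENNReal.inv_ne_top.2 hk0)
  rw [ENNReal.coe_toNNReal hCt,
    eLpNorm_eq_lintegral_rpow_enorm_toReal two_ne_zero ENNReal.ofNat_ne_top,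
    eLpNorm_eq_lintegral_rpow_enorm_toReal two_ne_zero ENNReal.ofNat_ne_top]
  simp only [ENNReal.toReal_ofNat]
  rw [← ENNReal.mul_rpow_of_nonneg _ _ (by norm_num)]
  refine ENNReal.rpow_le_rpow ?_ (by norm_num)
  rw [← ENNReal.div_eq_inv_mul, ENNReal.le_div_iff_mul_le (Or.inl hk0) (Or.inl hkt)]
  have hu0 : ∫⁻ x, ‖u x‖ₑ ^ (2 : ℝ) = ∫⁻ x in S.Ω, ‖u x‖ₑ ^ (2 : ℝ) := by
    rw [← lintegral_indicator S.isOpen_Ω.measurableSet]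
    refine lintegral_congr_ae ?_
    filter_upwards [u.ae_eq_zero] with x hx
    by_cases h : x ∈ S.Ω
    · simp [h]
    · simp [h, hx h]
  have hum : AEMeasurable (fun x => ‖u x‖ₑ ^ (2 : ℝ)) (volume.restrict S.Ω) :=
    (u.memLp_restrict.1.enorm).pow_const _
  have hprod : (∫⁻ x in S.Ω, ‖u x‖ₑ ^ (2 : ℝ)) * k =
      ∫⁻ p in S.Ω ×ˢ B, ‖u p.1‖ₑ ^ (2 : ℝ) * ENNReal.ofReal c ∂(volume.prod volume) := by
    rw [← Measure.prod_restrict, lintegral_prod_mul hum aemeasurable_const]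
    simp [hk]
  rw [hu0, hprod, Measure.volume_eq_prod]
  refine le_trans ?_ (setLIntegral_le_lintegral (S.Ω ×ˢ B) _)
  have hms : MeasurableSet (S.Ω ×ˢ B) :=
    S.isOpen_Ω.measurableSet.prod Metric.isOpen_ball.measurableSet
  refine lintegral_mono_ae ((ae_restrict_iff' hms).2 ?_)
  have h2 := (Measure.quasiMeasurePreserving_snd (μ := (volume : Measure S.E))
    (ν := (volume : Measure S.E))).ae u.ae_eq_zero
  filter_upwards [h2] with p hp hpm
  obtain ⟨g1, g2⟩ := hgeo p.1 hpm.1 p.2 hpm.2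
  simp only [diffq, hp g1, sub_zero, enorm_mul]
  rw [ENNReal.mul_rpow_of_nonneg _ _ (by norm_num)]
  gcongr
  rw [Real.enorm_eq_ofReal (Real.sqrt_nonneg _),
    ENNReal.ofReal_rpow_of_nonneg (Real.sqrt_nonneg _) (by norm_num)]
  refine ENNReal.ofReal_le_ofReal ?_
  rw [Real.rpow_two, Real.sq_sqrt (hcpos.le.trans g2)]
  exact g2

lemma norm_toL2_bound (S : NonlocalSetting) : ∃ C : NNReal, ∀ u : S.X0,
    ‖u.memLp.toLp‖ ≤ C * ‖S.toL2 u‖ := by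
  obtain ⟨C, hC⟩ := S.exists_poincare
  refine ⟨C, fun u => ?_⟩
  rw [Lp.norm_toLp, show S.toL2 u = u.memLp_diffq.toLp from rfl, Lp.norm_toLp,
    ← ENNReal.coe_toReal, ← ENNReal.toReal_mul]
  exact ENNReal.toReal_mono (ENNReal.mul_ne_top ENNReal.coe_ne_top u.memLp_diffq.2.ne) (hC u)

lemma toL2_injective (S : NonlocalSetting) : ∀ u : S.X0, S.toL2 u = 0 → u = 0 := by
  intro u hu
  obtain ⟨C, hC⟩ := S.norm_toL2_bound
  have h1 := hC u
  rw [hu, norm_zero, mul_zero] at h1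
  have h2 : u.memLp.toLp = 0 := norm_le_zero_iff.1 h1
  have h3 := (MemLp.toLp_eq_toLp_iff u.memLp MemLp.zero).1 (h2.trans (MemLp.toLp_zero _).symm)
  refine Subtype.ext (AEEqFun.ext (h3.trans AEEqFun.coeFn_zero.symm))

/-- The inner product axioms on `X₀`. -/
@[reducible] def X0.core (S : NonlocalSetting) : InnerProductSpace.Core ℝ S.X0 where
  inner u v := inner ℝ u v
  conj_inner_symm u v := by
    simp only [X0.inner_eq, conj_trivial]
    exact real_inner_comm _ _
  re_inner_nonneg u := by
    rw [X0.inner_eq]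
    exact real_inner_self_nonneg (x := S.toL2 u)
  add_left u v w := by simp only [X0.inner_eq, map_add, inner_add_left]
  smul_left u v r := by simp only [X0.inner_eq, map_smul, inner_smul_left]
  definite u h := by
    refine S.toL2_injective u ?_
    rw [X0.inner_eq] at h
    exact (inner_self_eq_zero (𝕜 := ℝ)).1 h

/-- The norm `‖u‖² = ∬ |u x - u y|² K(x - y) dx dy` of `X₀`. -/
instance : NormedAddCommGroup S.X0 := (X0.core S).toNormedAddCommGroup

instance : InnerProductSpace ℝ S.X0 := InnerProductSpace.ofCore (X0.core S).toCore

lemma X0.norm_eq (u : S.X0) : ‖u‖ = ‖S.toL2 u‖ := by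
  rw [norm_eq_sqrt_real_inner u, norm_eq_sqrt_real_inner (S.toL2 u)]
  exact congrArg _ (X0.inner_eq u u)

instance : CompleteSpace S.X0 := by
  refine Metric.complete_of_cauchySeq_tendsto fun u hu => ?_
  obtain ⟨C, hC⟩ := S.norm_toL2_bound
  have hT : CauchySeq fun j => S.toL2 (u j) := by
    rw [Metric.cauchySeq_iff] at hu ⊢
    intro ε hε
    obtain ⟨N, hN⟩ := hu ε hε
    refine ⟨N, fun i hi j hj => ?_⟩
    have := hN i hi j hj
    rwa [dist_eq_norm, X0.norm_eq, map_sub, ← dist_eq_norm] at this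
  have hsub : ∀ a b : S.X0, a.memLp.toLp - b.memLp.toLp = (a - b).memLp.toLp := by
    intro a b
    rw [← MemLp.toLp_sub]
    exact (MemLp.toLp_congr _ _ (AEEqFun.coeFn_sub a.1 b.1)).symm
  have hL : CauchySeq fun j => (u j).memLp.toLp := by
    rw [Metric.cauchySeq_iff] at hu ⊢
    intro ε hε
    obtain ⟨N, hN⟩ := hu (ε / (C + 1)) (by positivity)
    refine ⟨N, fun i hi j hj => ?_⟩
    have h1 := hN i hi j hj
    rw [dist_eq_norm, X0.norm_eq, lt_div_iff₀ (by positivity)] at h1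
    rw [dist_eq_norm, hsub]
    have h2 := hC (u i - u j)
    nlinarith [norm_nonneg (S.toL2 (u i - u j))]
  obtain ⟨w, hw⟩ := cauchySeq_tendsto_of_complete hT
  obtain ⟨v, hv⟩ := cauchySeq_tendsto_of_complete hL
  obtain ⟨ns, hns, hvae⟩ := (tendstoInMeasure_of_tendsto_Lp hv).exists_seq_tendsto_ae
  obtain ⟨ms, hms, hwae⟩ :=
    (tendstoInMeasure_of_tendsto_Lp (hw.comp hns.tendsto_atTop)).exists_seq_tendsto_ae
  have hv1 : ∀ᵐ x, Tendsto (fun i => u (ns (ms i)) x) atTop (𝓝 (v x)) := by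
    have hall : ∀ᵐ x : S.E, ∀ j, ((u j).memLp.toLp : S.E → ℝ) x = u j x :=
      ae_all_iff.2 fun j => (u j).memLp.coeFn_toLp
    filter_upwards [hvae, hall] with x hx hj
    simpa [hj, Function.comp_def] using hx.comp hms.tendsto_atTop
  have hw1 : ∀ᵐ p, Tendsto (fun i => S.diffq (u (ns (ms i))) p) atTop (𝓝 (w p)) := by
    have hall : ∀ᵐ p, ∀ j, (S.toL2 (u j)) p = S.diffq (u j) p :=
      ae_all_iff.2 fun j => (u j).memLp_diffq.coeFn_toLp
    filter_upwards [hwae, hall] with p hp hj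
    simpa [hj] using hp
  have hdiff : S.diffq v =ᵐ[volume] w := by
    have h1 := (Measure.quasiMeasurePreserving_fst (μ := (volume : Measure S.E))
      (ν := (volume : Measure S.E))).ae hv1
    have h2 := (Measure.quasiMeasurePreserving_snd (μ := (volume : Measure S.E))
      (ν := (volume : Measure S.E))).ae hv1
    rw [← Measure.volume_eq_prod] at h1 h2
    filter_upwards [h1, h2, hw1] with p a b c
    exact tendsto_nhds_unique ((a.sub b).mul_const _) c
  have hmemd : MemLp (S.diffq v) 2 volume := (memLp_congr_ae hdiff).2 (Lp.memLp w)
  have hv0 : ∀ᵐ x, x ∉ S.Ω → v x = 0 := by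
    have hall : ∀ᵐ x, ∀ j, x ∉ S.Ω → u j x = 0 := ae_all_iff.2 fun j => (u j).ae_eq_zero
    filter_upwards [hv1, hall] with x hx hj hxΩ
    exact tendsto_nhds_unique hx (by simp [hj _ hxΩ])
  refine ⟨(⟨(v : S.E →ₘ[volume] ℝ), (Lp.memLp v).restrict _, hmemd.restrict _,
    (ae_restrict_iff' S.isOpen_Ω.measurableSet.compl).2 hv0⟩ : S.X0Submodule), ?_⟩
  set v' : S.X0 := (⟨(v : S.E →ₘ[volume] ℝ), (Lp.memLp v).restrict _, hmemd.restrict _,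
    (ae_restrict_iff' S.isOpen_Ω.measurableSet.compl).2 hv0⟩ : S.X0Submodule) with hv'
  have hTv : S.toL2 v' = w := by
    refine Lp.ext ?_
    exact (v'.memLp_diffq.coeFn_toLp).trans hdiff
  rw [tendsto_iff_norm_sub_tendsto_zero]
  rw [tendsto_iff_norm_sub_tendsto_zero, ← hTv] at hw
  refine hw.congr fun j => ?_
  rw [X0.norm_eq, map_sub]

/-! ### The functional and its nonlinearity -/

variable (S)

/-- The primitive `F(x, t) = ∫₀ᵗ f(x, τ) dτ`. -/
def primitive (f : S.E → ℝ → ℝ) (x : S.E) (t : ℝ) : ℝ := ∫ τ in (0 : ℝ)..t, f x τ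

/-- The functional `𝒥_λ` on `X₀`. -/
def J (f : S.E → ℝ → ℝ) (lam : ℝ) (u : S.X0) : ℝ :=
  1 / 2 * (∫ p : S.E × S.E, |u p.1 - u p.2| ^ 2 * S.K (p.1 - p.2))
    - lam / 2 * (∫ x in S.Ω, |u x| ^ 2)
    - ∫ x in S.Ω, S.primitive f x (u x)

/-- The assumptions on the nonlinearity `f : Ω × ℝ → ℝ` with exponent `q`
(values of `f` outside `Ω` play no role). -/
structure IsNonlinearity (f : S.E → ℝ → ℝ) (q : ℝ) : Prop where
  /-- `f` is a Carathéodory function. -/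
  measurable : ∀ t, AEMeasurable (fun x => f x t) (volume.restrict S.Ω)
  continuous : ∀ᵐ x ∂(volume.restrict S.Ω), Continuous (f x)
  two_lt : 2 < q
  lt_critical : q < 2 * S.n / (S.n - 2 * S.s)
  growth : ∃ a₁ a₂ : ℝ, 0 < a₁ ∧ 0 < a₂ ∧
    ∀ᵐ x ∂(volume.restrict S.Ω), ∀ t, |f x t| ≤ a₁ + a₂ * |t| ^ (q - 1)
  primitive_lower : ∃ a₃ a₄ : ℝ, 0 < a₃ ∧ 0 < a₄ ∧
    ∀ᵐ x ∂(volume.restrict S.Ω), ∀ t, a₃ * |t| ^ q - a₄ ≤ S.primitive f x t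
  /-- `f(x, t) / |t| → 0` as `|t| → 0`, uniformly in `x ∈ Ω`. -/
  limit_zero : TendstoUniformlyOn (fun (t : ℝ) (x : S.E) => f x t / |t|) (fun _ => 0)
    (𝓝[≠] (0 : ℝ)) S.Ω
  superquadratic : ∀ᵐ x ∂(volume.restrict S.Ω), ∀ t, t ≠ 0 →
    0 < q * S.primitive f x t ∧ q * S.primitive f x t ≤ t * f x t

/-! ### Eigenvalues and eigenspaces -/

variable {S}

/-- `u` is a weak solution of `-𝓛_K u = lam u` in `Ω`, `u = 0` outside `Ω`. -/
def IsWeakEigen (lam : ℝ) (u : S.X0) : Prop :=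
  ∀ φ : S.X0,
    ∫ p : S.E × S.E, (u p.1 - u p.2) * (φ p.1 - φ p.2) * S.K (p.1 - p.2)
      = lam * ∫ x in S.Ω, u x * φ x

/-- `lam 1 ≤ lam 2 ≤ …` is the sequence of all eigenvalues of `-𝓛_K`, repeated according to
multiplicity, and `e 1, e 2, …` are corresponding eigenfunctions, orthonormal in `L²(Ω)`.
The entries with index `0` play no role.  The last field says that the enumeration is exhaustive. -/
structure IsEigenSequence (lam : ℕ → ℝ) (e : ℕ → S.X0) : Prop where
  mono : ∀ i j, 1 ≤ i → i ≤ j → lam i ≤ lam j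
  eigen : ∀ j, 1 ≤ j → IsWeakEigen (lam j) (e j)
  orthonormal : ∀ i j, 1 ≤ i → 1 ≤ j →
    ∫ x in S.Ω, e i x * e j x = if i = j then 1 else 0
  exhaustive : ∀ (μ : ℝ) (u : S.X0), IsWeakEigen μ u →
    u ∈ Submodule.span ℝ {v | ∃ j, 1 ≤ j ∧ lam j = μ ∧ v = e j}

/-- `ℍ_k = span {e₁, …, e_k}`. -/
def HSpace (e : ℕ → S.X0) (k : ℕ) : Submodule ℝ S.X0 :=
  Submodule.span ℝ (e '' Set.Icc 1 k)

/-- `ℙ_k = {u ∈ X₀ : ⟨u, e_j⟩ = 0 for j = 1, …, k}`. -/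
def PSpace (e : ℕ → S.X0) (k : ℕ) : Submodule ℝ S.X0 where
  carrier := {u | ∀ j, 1 ≤ j → j ≤ k → inner ℝ u (e j) = 0}
  zero_mem' := fun j _ _ => inner_zero_left _
  add_mem' := fun {u v} hu hv j h1 h2 => by rw [inner_add_left, hu j h1 h2, hv j h1 h2, add_zero]
  smul_mem' := fun c u hu j h1 h2 => by rw [inner_smul_left, hu j h1 h2, mul_zero]

lemma isClosed_PSpace (e : ℕ → S.X0) (k : ℕ) : IsClosed (PSpace e k : Set S.X0) := by
  have : (PSpace e k : Set S.X0) =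
      ⋂ j, ⋂ (_ : 1 ≤ j), ⋂ (_ : j ≤ k), {u : S.X0 | inner ℝ u (e j) = 0} := by
    ext u
    simp only [Set.mem_iInter]
    rfl
  rw [this]
  refine isClosed_iInter fun j => isClosed_iInter fun _ => isClosed_iInter fun _ => ?_
  exact isClosed_eq (continuous_id.inner continuous_const) continuous_const

instance (e : ℕ → S.X0) (k : ℕ) : FiniteDimensional ℝ (HSpace e k) :=
  FiniteDimensional.span_of_finite ℝ ((Set.finite_Icc 1 k).image e)

/-- `ℍ_k ⊕ ℙ_l` is closed, so the orthogonal projection onto it exists. -/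
instance (e : ℕ → S.X0) (k l : ℕ) : (HSpace e k ⊔ PSpace e l).HasOrthogonalProjection := by
  have hcl : IsClosed ((HSpace e k ⊔ PSpace e l : Submodule ℝ S.X0) : Set S.X0) := by
    rw [sup_comm]
    exact Submodule.isClosed_sup_finiteDimensional _ _ (isClosed_PSpace e l)
  have : CompleteSpace (HSpace e k ⊔ PSpace e l : Submodule ℝ S.X0) := hcl.completeSpace_coe
  infer_instance

end NonlocalSetting

/-- The condition `(∇)(I, C, a, b)` for a functional `I` on a Hilbert space and a closed subspace
`C`: for some `γ > 0`, the infimum of `‖P_C ∇I(u)‖` over all `u` with `a ≤ I u ≤ b` and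
`dist(u, C) ≤ γ` is positive (the infimum over the empty set being `+∞`). -/
def NablaCondition {H : Type*} [NormedAddCommGroup H] [InnerProductSpace ℝ H] [CompleteSpace H]
    (I : H → ℝ) (C : Submodule ℝ H) [C.HasOrthogonalProjection] (a b : EReal) : Prop :=
  ∃ γ : ℝ, 0 < γ ∧
    0 < ⨅ u ∈ {u : H | a ≤ (I u : EReal) ∧ (I u : EReal) ≤ b ∧
        Metric.infDist u (C : Set H) ≤ γ},
      ‖C.orthogonalProjectionOnto (gradient I u)‖ₑ

end

/-!
The functional has the form `½‖u‖² - (l/2) ⟨T u, u⟩ - Φ u`, where `T` represents the `L²(Ω)` inner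
product in `X₀` and `Φ u = ∫_Ω F(x, u)`. On `ℍ_{k-1}` its quadratic part is negative definite and on
`ℙ_{k+m-1}` it is positive definite, with a constant proportional to `σ`; the second fact is the
Poincaré inequality `λ_{N+1} ∫_Ω w² ≤ ‖w‖²` on `ℙ_N` (`IsEigenSequence.mul_inner_solOp_le`), which
holds because the norm of the compact self-adjoint operator `T` on `ℙ_N` is attained at an
eigenvalue and the enumeration of the eigenvalues is exhaustive.

Let `P` be the projection to `C = ℍ_{k-1} ⊕ ℙ_{k+m-1}`, let `P u = v + w`, and test the gradient with
`w - v`. This gives `c ‖P u‖ ≤ ‖P ∇J(u)‖ + O(dist(u, C)) + ‖∇Φ(u)‖`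
(`LinkingData.norm_proj_le`). It has two consequences. Since `∇Φ(u) = o(‖u‖)` at the origin, nonzero
critical points of `J` on `C` stay away from the origin. And since superquadraticity bounds `Φ(u)`
by a multiple of `2 J(u) - ⟨∇J(u), u⟩`, while `‖∇Φ(u)‖` is at most of order `(1 + Φ(u))^{(q-1)/q}`,
almost critical points close to `C` at bounded levels are bounded (`LinkingData.exists_bound`). As
`T` and `∇Φ` are compact, such points that become critical and approach `C` converge along a
subsequence to a critical point on `C` (`LinkingData.exists_limit`). If there were nonzero critical points on `C` at levels tending to
zero, their limit would be a nonzero critical point at level zero, which superquadraticity excludes;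
so there are none at small positive levels (`LinkingData.exists_no_critical`), and the failure of
the `∇`-condition would produce one.

The analytic input is the compact embedding of `X₀` into `L^q(Ω)`. The critical Sobolev inequality
(`exists_sobolev`) follows by comparing `u x` with the mean of `u` over a ball about `x` whose radius
is adapted to `|u x|`. The same comparison with means over the cubes of a fine grid exhibits the
embedding into `L²(Ω)` as a norm limit of finite rank operators
(`NonlocalSetting.isCompactOperator_embedTwo`), and interpolation between the two gives `L^q(Ω)`.
Differentiability of `Φ` reduces to the continuity of superposition operators from `L^q` to
`L^{q/(q-1)}` (`IsNemytskii.hasFDerivAt`), which is Vitali's convergence theorem.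
-/

/-! ### Functionals with linking geometry on a Hilbert space -/

/-- Data of a family of functionals `½‖u‖² - l/2 ⟨T u, u⟩ - Φ u` on a Hilbert space that have the
linking geometry relative to the orthogonal subspaces `V` (where the quadratic part is negative
definite, uniformly in `l ∈ [α, β]`) and `W` (where it is positive definite); `N` is the gradient
of the superquadratic perturbation `Φ`. -/
structure LinkingData (H : Type*) [NormedAddCommGroup H] [InnerProductSpace ℝ H]
    [CompleteSpace H] where
  T : H →L[ℝ] H
  N : H → H
  Φ : H → ℝ
  I : ℝ → H → ℝ
  V : Submodule ℝ H
  W : Submodule ℝ H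
  c : ℝ
  α : ℝ
  β : ℝ
  q : ℝ
  r : ℝ
  D : ℝ
  c_pos : 0 < c
  two_lt_q : 2 < q
  one_lt_r : 1 < r
  I_eq : ∀ l u, I l u = 1 / 2 * ‖u‖ ^ 2 - l / 2 * inner ℝ (T u) u - Φ u
  hasGradientAt : ∀ l u, HasGradientAt (I l) (u - l • T u - N u) u
  T_symm : ∀ u v, inner ℝ (T u) v = inner ℝ u (T v)
  orthogonal : ∀ v ∈ V, ∀ w ∈ W, inner ℝ v w = 0
  negative : ∀ l ∈ Set.Icc α β, ∀ v ∈ V, c * ‖v‖ ^ 2 ≤ l * inner ℝ (T v) v - ‖v‖ ^ 2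
  positive : ∀ l ∈ Set.Icc α β, ∀ w ∈ W, c * ‖w‖ ^ 2 ≤ ‖w‖ ^ 2 - l * inner ℝ (T w) w
  superquadratic : ∀ u, q * Φ u ≤ inner ℝ (N u) u
  Φ_zero : Φ 0 = 0
  Φ_pos : ∀ u, u ≠ 0 → 0 < Φ u
  N_growth : ∀ u, ‖N u‖ ^ r ≤ D * (1 + Φ u)
  N_small : ∀ ε : ℝ, 0 < ε → ∃ δ : ℝ, 0 < δ ∧ ∀ u, ‖u‖ < δ → ‖N u‖ ≤ ε * ‖u‖
  N_continuous : Continuous N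
  compact : ∀ (u : ℕ → H) (R : ℝ), (∀ j, ‖u j‖ ≤ R) → ∃ φ : ℕ → ℕ, StrictMono φ ∧
    ∃ a b : H, Tendsto (fun j => T (u (φ j))) atTop (𝓝 a) ∧
      Tendsto (fun j => N (u (φ j))) atTop (𝓝 b)

namespace LinkingData

variable {H : Type*} [NormedAddCommGroup H] [InnerProductSpace ℝ H] [CompleteSpace H]
  (L : LinkingData H)

/-- The gradient of `L.I l` at `u`. -/
def grad (l : ℝ) (u : H) : H := u - l • L.T u - L.N u

lemma gradient_eq (l : ℝ) (u : H) : gradient (L.I l) u = L.grad l u :=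
  (L.hasGradientAt l u).gradient

lemma continuous_grad : Continuous fun p : ℝ × H => L.grad p.1 p.2 := by
  have := L.N_continuous
  unfold grad
  fun_prop

lemma continuous_Φ : Continuous L.Φ := by
  have h1 : Continuous (L.I 0) := continuous_iff_continuousAt.2 fun u =>
    (L.hasGradientAt 0 u).continuousAt
  have h2 : L.Φ = fun u => 1 / 2 * ‖u‖ ^ 2 - L.I 0 u := by
    funext u
    rw [L.I_eq]
    ring
  rw [h2]
  fun_prop

lemma continuous_I : Continuous fun p : ℝ × H => L.I p.1 p.2 := by
  have := L.continuous_Φ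
  simp only [L.I_eq]
  fun_prop

/-- Testing the gradient with `w - v`, where `v + w` is the projection of `u` to `V ⊔ W`, bounds
this projection by the nonlinear term. -/
lemma norm_proj_le [(L.V ⊔ L.W).HasOrthogonalProjection] {l : ℝ} (hl : l ∈ Set.Icc L.α L.β)
    (u : H) :
    L.c * ‖(L.V ⊔ L.W).starProjection u‖ ≤ ‖(L.V ⊔ L.W).starProjection (L.grad l u)‖ +
      |l| * ‖L.T‖ * ‖u - (L.V ⊔ L.W).starProjection u‖ + ‖L.N u‖ := by
  set P := (L.V ⊔ L.W).starProjection with hP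
  have hpu : P u ∈ L.V ⊔ L.W := (L.V ⊔ L.W).starProjection_apply_mem u
  obtain ⟨v, hv, w, hw, hvw⟩ := Submodule.mem_sup.1 hpu
  have hs : w - v ∈ L.V ⊔ L.W := sub_mem (Submodule.mem_sup_right hw) (Submodule.mem_sup_left hv)
  have ho : inner ℝ v w = 0 := L.orthogonal v hv w hw
  have ho' : inner ℝ w v = 0 := by rw [real_inner_comm]; exact ho
  have hn1 : ‖P u‖ ^ 2 = ‖v‖ ^ 2 + ‖w‖ ^ 2 := by
    rw [← hvw, norm_add_sq_real, ho]
    ring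
  have hn2 : ‖w - v‖ = ‖P u‖ := by
    refine (sq_eq_sq₀ (norm_nonneg _) (norm_nonneg _)).1 ?_
    rw [hn1, norm_sub_sq_real, ho']
    ring
  have hproj : ∀ z : H, inner ℝ (P z) (w - v) = inner ℝ z (w - v) := by
    intro z
    rw [hP, Submodule.inner_starProjection_left_eq_right,
      Submodule.starProjection_eq_self_iff.2 hs]
  have e1 : inner ℝ u (w - v) = ‖w‖ ^ 2 - ‖v‖ ^ 2 := by
    rw [← hproj, ← hvw]
    simp only [inner_add_left, inner_sub_right, ho, ho', real_inner_self_eq_norm_sq]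
    ring
  have e2 : inner ℝ (L.T (P u)) (w - v) = inner ℝ (L.T w) w - inner ℝ (L.T v) v := by
    rw [← hvw]
    simp only [map_add, inner_add_left, inner_sub_right]
    rw [L.T_symm v w, real_inner_comm]
    ring
  have e3 : inner ℝ (L.grad l u) (w - v) = ‖w‖ ^ 2 - ‖v‖ ^ 2 -
      l * (inner ℝ (L.T w) w - inner ℝ (L.T v) v) - l * inner ℝ (L.T (u - P u)) (w - v)
      - inner ℝ (L.N u) (w - v) := by
    rw [← e2, grad, inner_sub_left, inner_sub_left, e1, real_inner_smul_left, map_sub,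
      inner_sub_left]
    ring
  have i1 := real_inner_le_norm (P (L.grad l u)) (w - v)
  rw [hproj, hn2] at i1
  have i2 := real_inner_le_norm (L.N u) (w - v)
  rw [hn2] at i2
  have i3 : l * inner ℝ (L.T (u - P u)) (w - v) ≤ |l| * ‖L.T‖ * ‖u - P u‖ * ‖P u‖ := by
    refine (le_abs_self _).trans ?_
    rw [abs_mul, mul_assoc, mul_assoc]
    refine mul_le_mul_of_nonneg_left ?_ (abs_nonneg l)
    refine (abs_real_inner_le_norm _ _).trans ?_
    rw [hn2, ← mul_assoc]
    exact mul_le_mul_of_nonneg_right (L.T.le_opNorm _) (norm_nonneg _)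
  have j1 := L.negative l hl v hv
  have j2 := L.positive l hl w hw
  have key : L.c * ‖P u‖ * ‖P u‖ ≤
      (‖P (L.grad l u)‖ + |l| * ‖L.T‖ * ‖u - P u‖ + ‖L.N u‖) * ‖P u‖ := by
    have : L.c * ‖P u‖ * ‖P u‖ = L.c * ‖v‖ ^ 2 + L.c * ‖w‖ ^ 2 := by
      rw [mul_assoc, ← sq, hn1]; ring
    rw [this]
    nlinarith
  rcases (norm_nonneg (P u)).eq_or_lt with h | h
  · rw [← h, mul_zero]
    positivity
  · exact le_of_mul_le_mul_right key h

lemma Φ_nonneg (u : H) : 0 ≤ L.Φ u := by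
  by_cases hu : u = 0
  · rw [hu, L.Φ_zero]
  · exact (L.Φ_pos u hu).le

/-- Twice the functional minus its radial derivative controls `Φ`. -/
lemma Φ_le (l : ℝ) (u : H) : (L.q - 2) * L.Φ u ≤ 2 * L.I l u - inner ℝ (L.grad l u) u := by
  have h1 := L.superquadratic u
  rw [L.I_eq, grad, inner_sub_left, inner_sub_left, real_inner_smul_left,
    real_inner_self_eq_norm_sq]
  linarith

/-- Almost critical points at bounded levels, close to `V ⊔ W`, are bounded uniformly in `l`. -/
lemma exists_bound [(L.V ⊔ L.W).HasOrthogonalProjection] :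
    ∃ R : ℝ, ∀ l ∈ Set.Icc L.α L.β, ∀ u : H, L.I l u ≤ 1 →
      ‖(L.V ⊔ L.W).starProjection (L.grad l u)‖ ≤ 1 →
      ‖u - (L.V ⊔ L.W).starProjection u‖ ≤ 1 → ‖u‖ ≤ R := by
  set P := (L.V ⊔ L.W).starProjection with hP
  set M : ℝ := max |L.α| |L.β| with hM
  set t : ℝ := ‖L.T‖ with ht
  have hM0 : 0 ≤ M := (abs_nonneg _).trans (le_max_left _ _)
  have ht0 : 0 ≤ t := norm_nonneg _
  have hc := L.c_pos
  -- `‖u‖ ≤ A (1 + ‖N u‖)`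
  set A : ℝ := (1 + M * t + 1) / L.c + 1 with hA
  have hA0 : 0 ≤ A := by positivity
  -- `Φ u ≤ B (1 + ‖N u‖)`
  set B : ℝ := (2 + A + (A + M * t * A + 1)) / (L.q - 2) with hB
  have hq : 0 < L.q - 2 := by linarith [L.two_lt_q]
  have hB0 : 0 ≤ B := by positivity
  obtain ⟨Z, hZ⟩ : ∃ Z : ℝ, ∀ x : ℝ, 0 ≤ x → x ^ L.r ≤ |L.D| * (1 + B * (1 + x)) → x ≤ Z := by
    have h1 : Tendsto (fun x : ℝ => x ^ (L.r - 1)) atTop atTop :=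
      tendsto_rpow_atTop (by linarith [L.one_lt_r])
    obtain ⟨Z, hZ⟩ := (eventually_atTop.1 (h1.eventually_gt_atTop (|L.D| * (1 + 2 * B))))
    refine ⟨max Z 1, fun x hx h => ?_⟩
    by_contra! hcon
    have hx1 : 1 < x := (le_max_right _ _).trans_lt hcon
    have h2 := hZ x ((le_max_left _ _).trans hcon.le)
    have h3 : x ^ L.r = x ^ (L.r - 1) * x := by
      rw [← Real.rpow_add_one (by positivity)]; ring_nf
    rw [h3] at h
    have h4 : |L.D| * (1 + B * (1 + x)) ≤ |L.D| * (1 + 2 * B) * x := by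
      rw [mul_assoc]
      refine mul_le_mul_of_nonneg_left ?_ (abs_nonneg _)
      nlinarith
    have h5 : |L.D| * (1 + 2 * B) * x < x ^ (L.r - 1) * x :=
      mul_lt_mul_of_pos_right h2 (by linarith)
    linarith
  refine ⟨A * (1 + Z), fun l hl u hI hg hz => ?_⟩
  have hlM : |l| ≤ M := abs_le_max_abs_abs hl.1 hl.2
  have k1 := L.norm_proj_le hl u
  rw [← hP] at k1
  set x : ℝ := ‖L.N u‖ with hx
  have hx0 : 0 ≤ x := norm_nonneg _
  have k2 : |l| * t * ‖u - P u‖ ≤ M * t := by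
    calc |l| * t * ‖u - P u‖ ≤ |l| * t * 1 := by gcongr
      _ ≤ M * t := by rw [mul_one]; gcongr
  have k3 : ‖P u‖ ≤ (1 + M * t + x) / L.c := by
    rw [le_div_iff₀ hc]
    linarith
  have k4 : ‖u‖ ≤ A * (1 + x) := by
    have h1 : ‖u‖ ≤ ‖P u‖ + ‖u - P u‖ := by
      have := norm_add_le (P u) (u - P u)
      rwa [add_sub_cancel] at this
    have h2 : (1 + M * t + x) / L.c ≤ (1 + M * t + 1) / L.c * (1 + x) := by
      rw [div_mul_eq_mul_div]
      gcongr
      nlinarith [mul_nonneg hM0 ht0, mul_nonneg (mul_nonneg hM0 ht0) hx0]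
    have h3 : A * (1 + x) = (1 + M * t + 1) / L.c * (1 + x) + (1 + x) := by rw [hA]; ring
    linarith
  have k5 := L.Φ_le l u
  have k6 : -inner ℝ (L.grad l u) u ≤ A * (1 + x) + (A + M * t * A + 1) * (1 + x) := by
    have h1 : inner ℝ (L.grad l u) u =
        inner ℝ (P (L.grad l u)) u + inner ℝ (L.grad l u) (u - P u) := by
      rw [hP, Submodule.inner_starProjection_left_eq_right, ← inner_add_right, add_sub_cancel]
    have h2 : |inner ℝ (P (L.grad l u)) u| ≤ 1 * ‖u‖ :=
      (abs_real_inner_le_norm _ _).trans (by gcongr)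
    have h3 : ‖L.grad l u‖ ≤ ‖u‖ + M * (t * ‖u‖) + x := by
      refine (norm_sub_le _ _).trans (add_le_add ((norm_sub_le _ _).trans ?_) le_rfl)
      rw [norm_smul]
      gcongr
      · exact hlM
      · exact L.T.le_opNorm u
    have h4 : |inner ℝ (L.grad l u) (u - P u)| ≤ (‖u‖ + M * (t * ‖u‖) + x) * 1 :=
      (abs_real_inner_le_norm _ _).trans (by gcongr)
    have h5 : M * (t * ‖u‖) ≤ M * (t * (A * (1 + x))) := by gcongr
    have h6 := neg_abs_le (inner ℝ (P (L.grad l u)) u)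
    have h7 := neg_abs_le (inner ℝ (L.grad l u) (u - P u))
    nlinarith
  have k7 : L.Φ u ≤ B * (1 + x) := by
    rw [hB, div_mul_eq_mul_div, le_div_iff₀ hq]
    nlinarith
  have k8 : x ≤ Z := by
    refine hZ x hx0 ((L.N_growth u).trans ?_)
    have h0 : 0 ≤ L.Φ u := L.Φ_nonneg u
    exact mul_le_mul (le_abs_self _) (by linarith) (by linarith) (abs_nonneg _)
  refine k4.trans ?_
  gcongr

/-- The compactness condition: almost critical points for the projected gradient, close to
`V ⊔ W`, have a convergent subsequence, and the limit is critical on `V ⊔ W`. -/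
lemma exists_limit [(L.V ⊔ L.W).HasOrthogonalProjection] (l : ℕ → ℝ) (u : ℕ → H)
    (hl : ∀ j, l j ∈ Set.Icc L.α L.β) {R : ℝ} (hR : ∀ j, ‖u j‖ ≤ R)
    (hg : Tendsto (fun j => ‖(L.V ⊔ L.W).starProjection (L.grad (l j) (u j))‖) atTop (𝓝 0))
    (hd : Tendsto (fun j => ‖u j - (L.V ⊔ L.W).starProjection (u j)‖) atTop (𝓝 0)) :
    ∃ l' ∈ Set.Icc L.α L.β, ∃ u' ∈ L.V ⊔ L.W,
      (L.V ⊔ L.W).starProjection (L.grad l' u') = 0 ∧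
      ∃ φ : ℕ → ℕ, StrictMono φ ∧ Tendsto (fun j => l (φ j)) atTop (𝓝 l') ∧
        Tendsto (fun j => u (φ j)) atTop (𝓝 u') := by
  set P := (L.V ⊔ L.W).starProjection with hP
  obtain ⟨l', hl', φ, hφ, hlφ⟩ := isCompact_Icc.tendsto_subseq hl
  obtain ⟨ψ, hψ, a, b, ha, hb⟩ := L.compact (fun j => u (φ j)) R fun j => hR _
  have hχ : StrictMono (φ ∘ ψ) := hφ.comp hψ
  have hlim : Tendsto (fun j => u (φ (ψ j))) atTop (𝓝 (P (l' • a + b))) := by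
    have h1 : Tendsto (fun j => P (l (φ (ψ j)) • L.T (u (φ (ψ j))) + L.N (u (φ (ψ j))))) atTop
        (𝓝 (P (l' • a + b))) :=
      (P.continuous.tendsto _).comp (((hlφ.comp hψ.tendsto_atTop).smul ha).add hb)
    have h2 := tendsto_zero_iff_norm_tendsto_zero.2 (hg.comp hχ.tendsto_atTop)
    have h3 := tendsto_zero_iff_norm_tendsto_zero.2 (hd.comp hχ.tendsto_atTop)
    have h4 := (h1.add h2).add h3
    simp only [add_zero] at h4
    refine h4.congr fun j => ?_
    simp only [Function.comp, grad, map_add, map_sub]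
    abel
  have hlχ : Tendsto (fun j => l (φ (ψ j))) atTop (𝓝 l') := hlφ.comp hψ.tendsto_atTop
  refine ⟨l', hl', P (l' • a + b), (L.V ⊔ L.W).starProjection_apply_mem _, ?_, φ ∘ ψ, hχ, hlχ, hlim⟩
  have h1 := (P.continuous.tendsto _).comp
    ((L.continuous_grad.tendsto (l', P (l' • a + b))).comp (hlχ.prodMk_nhds hlim))
  have h2 := tendsto_zero_iff_norm_tendsto_zero.2 (hg.comp hχ.tendsto_atTop)
  exact tendsto_nhds_unique h1 h2

/-- Near level zero, the functional has no nontrivial critical point on `V ⊔ W`. -/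
lemma exists_no_critical [(L.V ⊔ L.W).HasOrthogonalProjection] :
    ∃ ε : ℝ, 0 < ε ∧ ε ≤ 1 ∧ ∀ l ∈ Set.Icc L.α L.β, ∀ u ∈ L.V ⊔ L.W,
      (L.V ⊔ L.W).starProjection (L.grad l u) = 0 → u ≠ 0 → ε ≤ |L.I l u| := by
  obtain ⟨R, hR⟩ := L.exists_bound
  set P := (L.V ⊔ L.W).starProjection with hP
  obtain ⟨δ, hδ, hsm⟩ := L.N_small (L.c / 2) (half_pos L.c_pos)
  -- nontrivial critical points stay away from the origin
  have haway : ∀ l ∈ Set.Icc L.α L.β, ∀ u ∈ L.V ⊔ L.W, P (L.grad l u) = 0 → u ≠ 0 → δ ≤ ‖u‖ := by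
    intro l hl u hu hg hne
    by_contra! hlt
    have h1 := L.norm_proj_le hl u
    rw [← hP, hg, Submodule.starProjection_eq_self_iff.2 hu, sub_self, norm_zero, mul_zero,
      zero_add, zero_add] at h1
    have h2 := hsm u hlt
    have h3 : 0 < L.c * ‖u‖ := mul_pos L.c_pos (norm_pos_iff.2 hne)
    linarith
  by_contra! hcon
  choose l hl u hu hg hne hI using fun j : ℕ =>
    hcon (1 / ((j : ℝ) + 1)) (by positivity) (by
      rw [div_le_one (by positivity)]
      have : (0 : ℝ) ≤ j := Nat.cast_nonneg j
      linarith)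
  have hIj : ∀ j, |L.I (l j) (u j)| ≤ 1 := fun j => (hI j).le.trans (by
    rw [div_le_one (by positivity)]
    have : (0 : ℝ) ≤ j := Nat.cast_nonneg j
    linarith)
  have hfix : ∀ j, P (u j) = u j := fun j => Submodule.starProjection_eq_self_iff.2 (hu j)
  have hb : ∀ j, ‖u j‖ ≤ R := fun j => hR (l j) (hl j) (u j) ((le_abs_self _).trans (hIj j))
    (by rw [hg j, norm_zero]; exact zero_le_one) (by
      have := hfix j
      rw [this, sub_self, norm_zero]; exact zero_le_one)
  obtain ⟨l', hl', u', hu', hg', φ, hφ, hlφ, huφ⟩ := L.exists_limit l u hl hb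
    (by
      refine tendsto_const_nhds.congr fun j => ?_
      rw [← hP, hg j, norm_zero])
    (by
      refine tendsto_const_nhds.congr fun j => ?_
      rw [← hP, hfix j, sub_self, norm_zero])
  have h1 : Tendsto (fun j => L.I (l (φ j)) (u (φ j))) atTop (𝓝 (L.I l' u')) :=
    (L.continuous_I.tendsto (l', u')).comp (hlφ.prodMk_nhds huφ)
  have h2 : Tendsto (fun j => L.I (l (φ j)) (u (φ j))) atTop (𝓝 0) := by
    refine squeeze_zero_norm (fun j => (hI (φ j)).le) ?_
    exact tendsto_one_div_add_atTop_nhds_zero_nat.comp hφ.tendsto_atTop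
  have h3 : L.I l' u' = 0 := tendsto_nhds_unique h1 h2
  have h4 : δ ≤ ‖u'‖ := ge_of_tendsto huφ.norm
    (Eventually.of_forall fun j => haway _ (hl _) _ (hu _) (hg _) (hne _))
  have h5 : u' ≠ 0 := norm_pos_iff.1 (hδ.trans_le h4)
  have h6 := L.Φ_le l' u'
  have h7 : inner ℝ (L.grad l' u') u' = 0 := by
    rw [← Submodule.starProjection_eq_self_iff.2 hu',
      ← Submodule.inner_starProjection_left_eq_right, Submodule.starProjection_eq_self_iff.2 hu',
      hg', inner_zero_left]
  rw [h3, h7] at h6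
  have h8 := mul_pos (by linarith [L.two_lt_q] : 0 < L.q - 2) (L.Φ_pos u' h5)
  linarith

/-- The `∇`-condition near level zero, uniformly in the parameter. -/
theorem nablaCondition [(L.V ⊔ L.W).HasOrthogonalProjection] :
    ∃ ε : ℝ, 0 < ε ∧ ∀ l ∈ Set.Icc L.α L.β, ∀ ε' ε'' : ℝ, 0 < ε' → ε'' < ε →
      NablaCondition (L.I l) (L.V ⊔ L.W) (ε' : EReal) (ε'' : EReal) := by
  obtain ⟨ε, hε, hε1, hno⟩ := L.exists_no_critical
  obtain ⟨R, hR⟩ := L.exists_bound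
  refine ⟨ε, hε, fun l hl ε' ε'' h' h'' => ?_⟩
  by_contra hcon
  simp only [NablaCondition, not_exists, not_and, not_lt, nonpos_iff_eq_zero] at hcon
  set P := (L.V ⊔ L.W).starProjection with hP
  have hex : ∀ j : ℕ, ∃ u : H, ε' ≤ L.I l u ∧ L.I l u ≤ ε'' ∧
      ‖u - P u‖ ≤ 1 / ((j : ℝ) + 1) ∧ ‖P (L.grad l u)‖ < 1 / ((j : ℝ) + 1) := by
    intro j
    have hj : (0 : ℝ) < 1 / ((j : ℝ) + 1) := by positivity
    have h1 := hcon _ hj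
    have h2 : (0 : ENNReal) < ENNReal.ofReal (1 / ((j : ℝ) + 1)) := ENNReal.ofReal_pos.2 hj
    rw [← h1] at h2
    simp only [iInf_lt_iff] at h2
    obtain ⟨u, ⟨hu1, hu2, hu3⟩, hu4⟩ := h2
    refine ⟨u, EReal.coe_le_coe_iff.1 hu1, EReal.coe_le_coe_iff.1 hu2, ?_, ?_⟩
    · rw [← dist_eq_norm]
      refine le_trans (le_of_eq ?_) hu3
      rw [Submodule.starProjection_apply, dist_eq_norm, Metric.infDist_eq_iInf]
      rw [← Submodule.starProjection_apply, Submodule.starProjection_minimal]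
      simp only [dist_eq_norm]
      rfl
    · rw [← ofReal_norm, ENNReal.ofReal_lt_ofReal_iff hj, gradient_eq] at hu4
      exact hu4
  choose u hu1 hu2 hu3 hu4 using hex
  have hle : ∀ j : ℕ, 1 / ((j : ℝ) + 1) ≤ 1 := fun j => by
    rw [div_le_one (by positivity)]
    have : (0 : ℝ) ≤ j := Nat.cast_nonneg j
    linarith
  have hb : ∀ j, ‖u j‖ ≤ R := fun j => hR l hl (u j) (by linarith [hu2 j])
    ((hu4 j).le.trans (hle j)) ((hu3 j).trans (hle j))
  have h0 : Tendsto (fun j : ℕ => 1 / ((j : ℝ) + 1)) atTop (𝓝 0) :=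
    tendsto_one_div_add_atTop_nhds_zero_nat
  obtain ⟨l', hl', u', hu', hg', φ, hφ, hlφ, huφ⟩ := L.exists_limit (fun _ => l) u (fun _ => hl) hb
    (squeeze_zero (fun _ => norm_nonneg _) (fun j => (hu4 j).le) h0)
    (squeeze_zero (fun _ => norm_nonneg _) hu3 h0)
  have h1 : Tendsto (fun j => L.I l (u (φ j))) atTop (𝓝 (L.I l' u')) :=
    (L.continuous_I.tendsto (l', u')).comp (hlφ.prodMk_nhds huφ)
  have h2 : ε' ≤ L.I l' u' := ge_of_tendsto h1 (Eventually.of_forall fun j => hu1 _)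
  have h3 : L.I l' u' ≤ ε'' := le_of_tendsto h1 (Eventually.of_forall fun j => hu2 _)
  have h4 : u' ≠ 0 := by
    intro h
    rw [h, L.I_eq, L.Φ_zero] at h2
    simp at h2
    linarith
  have h5 := hno l' hl' u' hu' hg' h4
  rw [abs_of_nonneg (h'.le.trans h2)] at h5
  linarith

end LinkingData

/-! ### Superposition operators between Lebesgue spaces -/

section Nemytskii

variable {α : Type*}

/-- The mean of `g x` over the segment from `v x` to `v x + h`. -/
noncomputable def segmentMean (g : α → ℝ → ℝ) (v : α → ℝ) (x : α) (h : ℝ) : ℝ :=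
  ∫ s in (0 : ℝ)..1, g x (v x + s * h)

lemma mul_segmentMean {g : α → ℝ → ℝ} (hc : ∀ x, Continuous (g x)) (v : α → ℝ) (x : α) (h : ℝ) :
    h * segmentMean g v x h = (∫ τ in (0 : ℝ)..(v x + h), g x τ) - ∫ τ in (0 : ℝ)..(v x), g x τ := by
  rw [intervalIntegral.integral_interval_sub_left ((hc x).intervalIntegrable _ _)
    ((hc x).intervalIntegrable _ _), segmentMean]
  have := intervalIntegral.mul_integral_comp_add_mul (f := g x) (a := 0) (b := 1) h (v x)
  simp only [mul_zero, add_zero, mul_one] at this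
  rw [← this]
  simp only [mul_comm]

variable [MeasurableSpace α]

/-- `g : α → ℝ → ℝ` is a jointly measurable Carathéodory function such that
`|g x t| ≤ A x + b |t| ^ κ` with `A ∈ L^p'`; it then induces a superposition operator from
`L^(κ p')` to `L^p'`. -/
structure IsNemytskii (μ : Measure α) (p' : ENNReal) (κ : ℝ) (g : α → ℝ → ℝ) : Prop where
  measurable : Measurable (Function.uncurry g)
  continuous : ∀ x, Continuous (g x)
  growth : ∃ (A : α → ℝ) (b : ℝ), MemLp A p' μ ∧ 0 ≤ b ∧ ∀ x t, |g x t| ≤ A x + b * |t| ^ κ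

lemma abs_add_rpow_le {κ : ℝ} (hκ : 0 ≤ κ) (x y : ℝ) :
    |x + y| ^ κ ≤ 2 ^ κ * |x| ^ κ + 2 ^ κ * |y| ^ κ := by
  rw [← Real.mul_rpow zero_le_two (abs_nonneg _), ← Real.mul_rpow zero_le_two (abs_nonneg _)]
  have h0 := abs_add_le x y
  rcases le_total |x| |y| with h | h
  · calc |x + y| ^ κ ≤ (2 * |y|) ^ κ := Real.rpow_le_rpow (abs_nonneg _) (by linarith) hκ
      _ ≤ _ := le_add_of_nonneg_left (Real.rpow_nonneg (by positivity) _)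
  · calc |x + y| ^ κ ≤ (2 * |x|) ^ κ := Real.rpow_le_rpow (abs_nonneg _) (by linarith) hκ
      _ ≤ _ := le_add_of_nonneg_right (Real.rpow_nonneg (by positivity) _)

lemma measurable_uncurry_of_continuous_snd {g : α → ℝ → ℝ} (hm : ∀ t, Measurable fun x => g x t)
    (hc : ∀ x, Continuous (g x)) : Measurable (Function.uncurry g) :=
  (measurable_uncurry_of_continuous_of_measurable (u := fun t x => g x t) hc hm).comp
    measurable_swap

variable {μ : Measure α} {p p' : ENNReal} {κ : ℝ}

lemma MemLp.abs_rpow {u : α → ℝ} (hκ : 0 < κ) (hp : p = p' * ENNReal.ofReal κ)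
    (hu : MemLp u p μ) : MemLp (fun x => |u x| ^ κ) p' μ := by
  refine ⟨(hu.1.aemeasurable.abs.pow_const κ).aestronglyMeasurable, ?_⟩
  have := eLpNorm_norm_rpow (μ := μ) (p := p') u hκ
  simp only [Real.norm_eq_abs] at this
  rw [this, ← hp]
  exact ENNReal.rpow_lt_top_of_nonneg hκ.le hu.2.ne

namespace IsNemytskii

variable {g : α → ℝ → ℝ}

lemma aestronglyMeasurable (hg : IsNemytskii μ p' κ g) {u : α → ℝ}
    (hu : AEStronglyMeasurable u μ) : AEStronglyMeasurable (fun x => g x (u x)) μ :=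
  (hg.measurable.comp_aemeasurable (aemeasurable_id.prodMk hu.aemeasurable)).aestronglyMeasurable

lemma memLp (hg : IsNemytskii μ p' κ g) (hκ : 0 < κ) (hp : p = p' * ENNReal.ofReal κ)
    {u : α → ℝ} (hu : MemLp u p μ) : MemLp (fun x => g x (u x)) p' μ := by
  obtain ⟨A, b, hA, hb, h⟩ := hg.growth
  refine (hA.add ((MemLp.abs_rpow hκ hp hu).const_mul b)).mono'
    (hg.aestronglyMeasurable hu.1) (Eventually.of_forall fun x => ?_)
  exact h x (u x)

/-- The superposition operator is continuous along convergent sequences. -/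
lemma tendsto_eLpNorm [IsFiniteMeasure μ] (hg : IsNemytskii μ p' κ g) (hκ : 0 < κ)
    (hp : p = p' * ENNReal.ofReal κ) (hp' : p' ≠ ⊤) (h1 : 1 ≤ p) (h1' : 1 ≤ p')
    {u : ℕ → α → ℝ} {w : α → ℝ} (hu : ∀ j, MemLp (u j) p μ) (hw : MemLp w p μ)
    (huw : Tendsto (fun j => eLpNorm (u j - w) p μ) atTop (𝓝 0)) :
    Tendsto (fun j => eLpNorm ((fun x => g x (u j x)) - fun x => g x (w x)) p' μ) atTop (𝓝 0) := by
  have hpt : p ≠ ⊤ := by rw [hp]; exact ENNReal.mul_ne_top hp' ENNReal.ofReal_ne_top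
  have hp0 : p ≠ 0 := (zero_lt_one.trans_le h1).ne'
  obtain ⟨A, b, hA, hb, hgr⟩ := hg.growth
  -- `|u j| ^ κ` is uniformly integrable because `u j` is
  have hui1 := unifIntegrable_of_tendsto_Lp h1 hpt hu hw huw
  have hui2 : UnifIntegrable (fun j x => |u j x| ^ κ) p' μ := by
    intro ε hε
    obtain ⟨δ, hδ, H⟩ := hui1 (ε := ε ^ κ⁻¹) (by positivity)
    refine ⟨δ, hδ, fun j s hs hμs => ?_⟩
    have e1 : s.indicator (fun x => |u j x| ^ κ) = fun x => ‖s.indicator (u j) x‖ ^ κ := by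
      ext x
      by_cases hx : x ∈ s
      · simp [hx]
      · simp [hx, Real.zero_rpow hκ.ne']
    rw [e1, eLpNorm_norm_rpow _ hκ, ← hp]
    refine (ENNReal.rpow_le_rpow (H j s hs hμs) hκ.le).trans ?_
    rw [ENNReal.ofReal_rpow_of_nonneg (by positivity) hκ.le, ← Real.rpow_mul hε.le,
      inv_mul_cancel₀ hκ.ne', Real.rpow_one]
  have hui3 : UnifIntegrable (fun j x => g x (u j x)) p' μ := by
    have hmeas : ∀ j, AEStronglyMeasurable (b • fun x => |u j x| ^ κ) μ := fun j =>
      ((MemLp.abs_rpow hκ hp (hu j)).const_smul b).1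
    have h4 : UnifIntegrable (fun j => b • fun x => |u j x| ^ κ) p' μ := by
      intro ε hε
      obtain ⟨δ, hδ, H⟩ := hui2 (ε := ε / (b + 1)) (by positivity)
      refine ⟨δ, hδ, fun j s hs hμs => ?_⟩
      have e2 : s.indicator (b • fun x => |u j x| ^ κ) = b • s.indicator fun x => |u j x| ^ κ :=
        Set.indicator_const_smul s b _
      rw [e2, eLpNorm_const_smul]
      refine (mul_le_mul_right (H j s hs hμs) _).trans ?_
      rw [Real.enorm_eq_ofReal hb, ← ENNReal.ofReal_mul hb]
      refine ENNReal.ofReal_le_ofReal ?_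
      rw [mul_div_assoc', div_le_iff₀ (by positivity)]
      nlinarith
    have h5 := (unifIntegrable_const (ι := ℕ) h1' hp' hA).add h4 h1' (fun _ => hA.1) hmeas
    intro ε hε
    obtain ⟨δ, hδ, H⟩ := h5 hε
    refine ⟨δ, hδ, fun j s hs hμs => (eLpNorm_mono fun x => ?_).trans (H j s hs hμs)⟩
    by_cases hx : x ∈ s
    · simp only [hx, Set.indicator_of_mem, Real.norm_eq_abs]
      exact (hgr x (u j x)).trans (le_abs_self _)
    · simp [hx]
  refine tendsto_of_subseq_tendsto fun ns hns => ?_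
  obtain ⟨ms, hms, hae⟩ := ((tendstoInMeasure_of_tendsto_eLpNorm hp0 (fun j => (hu j).1) hw.1
    huw).comp hns).exists_seq_tendsto_ae
  refine ⟨ms, tendsto_Lp_finite_of_tendsto_ae h1' hp' (fun j => hg.aestronglyMeasurable (hu _).1)
    (hg.memLp hκ hp hw) ?_ ?_⟩
  · intro ε hε
    obtain ⟨δ, hδ, H⟩ := hui3 hε
    exact ⟨δ, hδ, fun j => H _⟩
  · filter_upwards [hae] with x hx
    exact ((hg.continuous x).tendsto _).comp hx

lemma segmentMean [IsFiniteMeasure μ] (hg : IsNemytskii μ p' κ g) (hκ : 0 < κ)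
    (hp : p = p' * ENNReal.ofReal κ) {v : α → ℝ} (hvm : Measurable v)
    (hv : MemLp v p μ) : IsNemytskii μ p' κ (segmentMean g v) := by
  obtain ⟨A, b, hA, hb, hgr⟩ := hg.growth
  have hc : ∀ x, Continuous (_root_.segmentMean g v x) := by
    intro x
    have := hg.continuous x
    exact intervalIntegral.continuous_parametric_intervalIntegral_of_continuous' (by fun_prop) 0 1
  refine ⟨measurable_uncurry_of_continuous_snd (fun h => ?_) hc, hc, ?_⟩
  · have h1 : Measurable fun z : α × ℝ => g z.1 (v z.1 + z.2 * h) :=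
      hg.measurable.comp (measurable_fst.prodMk
        ((hvm.comp measurable_fst).add (measurable_snd.mul_const h)))
    have h2 : _root_.segmentMean g v = fun x h => ∫ s in Set.Ioc (0 : ℝ) 1, g x (v x + s * h) := by
      ext x h
      rw [_root_.segmentMean, intervalIntegral.integral_of_le zero_le_one]
    rw [h2]
    exact (h1.stronglyMeasurable.integral_prod_right').measurable
  · refine ⟨fun x => A x + b * (2 ^ κ * |v x| ^ κ), b * 2 ^ κ,
      hA.add (((MemLp.abs_rpow hκ hp hv).const_mul _).const_mul b), by positivity,
      fun x h => ?_⟩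
    have := intervalIntegral.norm_integral_le_of_norm_le_const (a := 0) (b := 1)
      (f := fun s => g x (v x + s * h))
      (C := A x + b * (2 ^ κ * |v x| ^ κ) + b * 2 ^ κ * |h| ^ κ) (fun s hs => by
        rw [Set.uIoc_of_le zero_le_one] at hs
        refine (hgr x _).trans ?_
        have h1 := abs_add_rpow_le hκ.le (v x) (s * h)
        have h2 : |s * h| ^ κ ≤ |h| ^ κ := by
          refine Real.rpow_le_rpow (abs_nonneg _) ?_ hκ.le
          rw [abs_mul, abs_of_pos hs.1]
          exact mul_le_of_le_one_left (abs_nonneg _) hs.2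
        have h3 : |v x + s * h| ^ κ ≤ 2 ^ κ * |v x| ^ κ + 2 ^ κ * |h| ^ κ :=
          h1.trans (by gcongr)
        have h4 := mul_le_mul_of_nonneg_left h3 hb
        linarith)
    simpa [_root_.segmentMean] using this

lemma integrable_primitive [IsFiniteMeasure μ] (hg : IsNemytskii μ p' κ g) (hκ : 0 < κ)
    (hp : p = p' * ENNReal.ofReal κ) [ENNReal.HolderConjugate p' p] {w : α → ℝ}
    (hw : MemLp w p μ) : Integrable (fun x => ∫ τ in (0 : ℝ)..(w x), g x τ) μ := by
  have h0 : IsNemytskii μ p' κ (_root_.segmentMean g fun _ => 0) :=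
    hg.segmentMean hκ hp measurable_const MemLp.zero
  refine ((h0.memLp hκ hp hw).integrable_mul hw).congr (Eventually.of_forall fun x => ?_)
  simpa [mul_comm] using mul_segmentMean hg.continuous (fun _ => 0) x (w x)

/-- The superposition operator `u ↦ g(·, u)` from `L^p` to `L^p'`, where `p = κ p'`. -/
noncomputable def op (hg : IsNemytskii μ p' κ g) (hκ : 0 < κ) (hp : p = p' * ENNReal.ofReal κ)
    (u : Lp ℝ p μ) : Lp ℝ p' μ :=
  (hg.memLp hκ hp (Lp.memLp u)).toLp

lemma coeFn_op (hg : IsNemytskii μ p' κ g) (hκ : 0 < κ) (hp : p = p' * ENNReal.ofReal κ)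
    (u : Lp ℝ p μ) : hg.op hκ hp u =ᵐ[μ] fun x => g x (u x) :=
  MemLp.coeFn_toLp _

/-- A pointwise bound of `g(·, w)` bounds the norm of the superposition operator. -/
lemma norm_op_le [Fact (1 ≤ p')] (hg : IsNemytskii μ p' κ g) (hκ : 0 < κ)
    (hp : p = p' * ENNReal.ofReal κ) (w : Lp ℝ p μ) {v : α → ℝ} (hv : MemLp v p' μ) {b : ℝ}
    (hb : 0 ≤ b) (h : ∀ᵐ x ∂μ, |g x (w x)| ≤ |v x| + b * |w x| ^ κ) :
    ‖hg.op hκ hp w‖ ≤ (eLpNorm v p' μ).toReal + b * ‖w‖ ^ κ := by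
  have hw := MemLp.abs_rpow hκ hp (Lp.memLp w)
  have h1 : eLpNorm (fun x => g x (w x)) p' μ ≤
      eLpNorm (fun x => |v x|) p' μ + eLpNorm (b • fun x => |w x| ^ κ) p' μ := by
    have hm1 : AEStronglyMeasurable (fun x => |v x|) μ := hv.1.norm
    have hm2 : AEStronglyMeasurable (b • fun x => |w x| ^ κ) μ := (hw.const_smul b).1
    refine le_trans (eLpNorm_mono_ae_real ?_) (eLpNorm_add_le hm1 hm2 Fact.out)
    filter_upwards [h] with x hx
    exact hx
  have h2 : eLpNorm (fun x => |w x| ^ κ) p' μ = eLpNorm w p μ ^ κ := by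
    have := eLpNorm_norm_rpow (μ := μ) (p := p') w hκ
    simp only [Real.norm_eq_abs] at this
    rw [this, ← hp]
  rw [eLpNorm_const_smul, h2, show (fun x => |v x|) = fun x => ‖v x‖ from rfl, eLpNorm_norm] at h1
  rw [IsNemytskii.op, Lp.norm_toLp]
  have h3 : ‖b‖ₑ * eLpNorm w p μ ^ κ ≠ ⊤ := ENNReal.mul_ne_top enorm_ne_top
    (ENNReal.rpow_ne_top_of_nonneg hκ.le (Lp.memLp w).2.ne)
  refine (ENNReal.toReal_mono (ENNReal.add_ne_top.2 ⟨hv.2.ne, h3⟩) h1).trans (le_of_eq ?_)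
  rw [ENNReal.toReal_add hv.2.ne h3, ENNReal.toReal_mul, ← ENNReal.toReal_rpow, Lp.norm_def,
    toReal_enorm, Real.norm_of_nonneg hb]

variable [IsFiniteMeasure μ] [Fact (1 ≤ p)] [Fact (1 ≤ p')]

lemma continuous_op (hg : IsNemytskii μ p' κ g) (hκ : 0 < κ) (hp : p = p' * ENNReal.ofReal κ)
    (hp' : p' ≠ ⊤) : Continuous (hg.op hκ hp : Lp ℝ p μ → Lp ℝ p' μ) := by
  refine continuous_iff_seqContinuous.2 fun u w huw => ?_
  refine (Lp.tendsto_Lp_iff_tendsto_eLpNorm'' _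
    (fun j => hg.memLp hκ hp (Lp.memLp (u j))) _ (hg.memLp hκ hp (Lp.memLp w))).2 ?_
  exact hg.tendsto_eLpNorm hκ hp hp' Fact.out Fact.out (fun j => Lp.memLp (u j)) (Lp.memLp w)
    ((Lp.tendsto_Lp_iff_tendsto_eLpNorm' _ _).1 huw)

variable [ENNReal.HolderConjugate p' p]

/-- The functional `u ↦ ∫ ∫₀^{u(x)} g(x, τ) dτ dx` on `L^p` is Fréchet differentiable, and its
derivative is the pairing with `g(·, u)`.  The difference quotient is itself a superposition
operator, so that the differentiability follows from the continuity of such operators. -/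
lemma hasFDerivAt (hg : IsNemytskii μ p' κ g) (hκ : 0 < κ) (hp : p = p' * ENNReal.ofReal κ)
    (hp' : p' ≠ ⊤) (u : Lp ℝ p μ) :
    HasFDerivAt (fun u : Lp ℝ p μ => ∫ x, (∫ τ in (0 : ℝ)..(u x), g x τ) ∂μ)
      ((ContinuousLinearMap.mul ℝ ℝ).lpPairing μ p' p (hg.op hκ hp u)) u := by
  have hu : IsNemytskii μ p' κ (_root_.segmentMean g u) :=
    hg.segmentMean hκ hp (Lp.stronglyMeasurable u).measurable (Lp.memLp u)
  set Q : Lp ℝ p μ → Lp ℝ p' μ := hu.op hκ hp with hQ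
  have hQc : Continuous Q := hu.continuous_op hκ hp hp'
  have hQ0 : Q 0 = hg.op hκ hp u := by
    refine Lp.ext ?_
    filter_upwards [hu.coeFn_op hκ hp 0, hg.coeFn_op hκ hp u, Lp.coeFn_zero ℝ p μ]
      with x h1 h2 h3
    rw [hQ, h1, h2, h3]
    simp [_root_.segmentMean]
  set B := (ContinuousLinearMap.mul ℝ ℝ).lpPairing μ p' p with hB
  have hdiff : ∀ h : Lp ℝ p μ, (∫ x, (∫ τ in (0 : ℝ)..((u + h : Lp ℝ p μ) x), g x τ) ∂μ) -
      ∫ x, (∫ τ in (0 : ℝ)..(u x), g x τ) ∂μ = B (Q h) h := by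
    intro h
    rw [← integral_sub (hg.integrable_primitive hκ hp (Lp.memLp _))
      (hg.integrable_primitive hκ hp (Lp.memLp _)), hB, ContinuousLinearMap.lpPairing_eq_integral]
    refine integral_congr_ae ?_
    filter_upwards [Lp.coeFn_add u h, hu.coeFn_op hκ hp h] with x h1 h2
    rw [h1, hQ, h2, Pi.add_apply, ← mul_segmentMean hg.continuous]
    simp [mul_comm]
  rw [hasFDerivAt_iff_isLittleO_nhds_zero, Asymptotics.isLittleO_iff]
  intro c hc
  have hev : ∀ᶠ h in 𝓝 (0 : Lp ℝ p μ), ‖Q h - Q 0‖ * ‖B‖ ≤ c := by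
    have : Tendsto (fun h => ‖Q h - Q 0‖ * ‖B‖) (𝓝 0) (𝓝 (‖Q 0 - Q 0‖ * ‖B‖)) :=
      Continuous.tendsto (by fun_prop) 0
    rw [sub_self, norm_zero, zero_mul] at this
    exact this.eventually_le_const hc
  filter_upwards [hev] with h hh
  rw [hdiff, ← hQ0, ← sub_apply, ← map_sub]
  refine (B.le_opNorm₂ _ _).trans ?_
  rw [mul_comm ‖B‖]
  gcongr

end IsNemytskii

/-- A Carathéodory function agrees, at almost every point, with a function that is jointly
measurable and continuous in the second variable everywhere; other properties valid almost
everywhere can be made to hold everywhere except for points where the new function vanishes. -/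
lemma exists_measurable_uncurry_ae_eq {f : α → ℝ → ℝ} (hm : ∀ t, AEMeasurable (fun x => f x t) μ)
    (hc : ∀ᵐ x ∂μ, Continuous (f x)) {P : (ℝ → ℝ) → Prop} (hP : ∀ᵐ x ∂μ, P (f x)) :
    ∃ g : α → ℝ → ℝ, (∀ᵐ x ∂μ, g x = f x) ∧ Measurable (Function.uncurry g) ∧
      (∀ x, Continuous (g x)) ∧ ∀ x, P (g x) ∨ g x = 0 := by
  classical
  have hgood : ∀ᵐ x ∂μ, (∀ r : ℚ, f x r = (hm r).mk (fun x => f x r) x) ∧ Continuous (f x) ∧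
      P (f x) := by
    filter_upwards [ae_all_iff.2 fun r : ℚ => (hm r).ae_eq_mk, hc, hP] with x h1 h2 h3
    exact ⟨h1, h2, h3⟩
  set A : Set α := (toMeasurable μ {x | ¬ ((∀ r : ℚ, f x r = (hm r).mk (fun x => f x r) x) ∧
    Continuous (f x) ∧ P (f x))})ᶜ with hA
  have hAm : MeasurableSet A := (measurableSet_toMeasurable _ _).compl
  have hAg : ∀ x ∈ A, (∀ r : ℚ, f x r = (hm r).mk (fun x => f x r) x) ∧ Continuous (f x) ∧
      P (f x) := by
    intro x hx
    by_contra h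
    exact hx (subset_toMeasurable μ _ h)
  have hAe : ∀ᵐ x ∂μ, x ∈ A := by
    rw [ae_iff]
    have : {x | ¬ x ∈ A} = Aᶜ := rfl
    rw [this, hA, compl_compl, measure_toMeasurable]
    exact ae_iff.1 hgood
  set g : α → ℝ → ℝ := fun x => if x ∈ A then f x else 0 with hg
  have hgA : ∀ x ∈ A, g x = f x := fun x hx => by simp [hg, hx]
  have hgA' : ∀ x ∉ A, g x = 0 := fun x hx => by simp [hg, hx]
  have hgc : ∀ x, Continuous (g x) := fun x => by
    by_cases hx : x ∈ A
    · rw [hgA x hx]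
      exact (hAg x hx).2.1
    · rw [hgA' x hx]
      exact continuous_zero
  have hgq : ∀ r : ℚ, Measurable fun x => g x r := fun r => by
    have : (fun x => g x r) = A.indicator ((hm r).mk (fun x => f x r)) := by
      ext x
      by_cases hx : x ∈ A
      · rw [hgA x hx, Set.indicator_of_mem hx, (hAg x hx).1 r]
      · rw [hgA' x hx, Set.indicator_of_notMem hx, Pi.zero_apply]
    rw [this]
    exact (hm r).measurable_mk.indicator hAm
  have hgm : ∀ t : ℝ, Measurable fun x => g x t := fun t => by
    obtain ⟨r, hr, hrt⟩ := mem_closure_iff_seq_limit.1 (Rat.denseRange_cast (𝕜 := ℝ) t)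
    choose ρ hρ using hr
    refine measurable_of_tendsto_metrizable (f := fun j x => g x (r j)) (fun j => ?_)
      (tendsto_pi_nhds.2 fun x => ((hgc x).tendsto t).comp hrt)
    rw [← hρ j]
    exact hgq (ρ j)
  refine ⟨g, ?_, measurable_uncurry_of_continuous_snd hgm hgc, hgc, fun x => ?_⟩
  · filter_upwards [hAe] with x hx
    exact hgA x hx
  · by_cases hx : x ∈ A
    · rw [hgA x hx]
      exact Or.inl (hAg x hx).2.2
    · exact Or.inr (hgA' x hx)

end Nemytskii

/-! ### The fractional Sobolev inequality -/

section Gagliardo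

variable {n : ℕ}

/-- The Gagliardo density `x ↦ ∫ |u x - u y|² |x - y|^{-(n + 2s)} dy`, whose integral is the square
of the Gagliardo seminorm of order `s`. -/
noncomputable def gagliardoDensity (s : ℝ) (u : EuclideanSpace ℝ (Fin n) → ℝ)
    (x : EuclideanSpace ℝ (Fin n)) : ENNReal :=
  ∫⁻ y, ‖u x - u y‖ₑ ^ 2 * ENNReal.ofReal (‖x - y‖ ^ (-((n : ℝ) + 2 * s)))

variable {s : ℝ} {u : EuclideanSpace ℝ (Fin n) → ℝ}

lemma eLpNorm_two_sq {α : Type*} [MeasurableSpace α] {μ : Measure α} (f : α → ℝ) :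
    eLpNorm f 2 μ ^ 2 = ∫⁻ x, ‖f x‖ₑ ^ 2 ∂μ := by
  have := eLpNorm_nnreal_pow_eq_lintegral (μ := μ) (f := f) (p := 2) two_ne_zero
  simpa using this

/-- The oscillation of `u` around `u x` on a set `Q` of radius `ρ` about `x` is controlled by the
Gagliardo density. -/
lemma eLpNorm_sub_le_gagliardoDensity (hs : 0 < s) (hu : Measurable u)
    (x : EuclideanSpace ℝ (Fin n)) {Q : Set (EuclideanSpace ℝ (Fin n))} (hQ : MeasurableSet Q)
    {ρ : ℝ} (hρ : 0 ≤ ρ) (hQρ : ∀ y ∈ Q, ‖x - y‖ ≤ ρ) :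
    eLpNorm (fun y => u x - u y) 1 (volume.restrict Q) ^ 2 ≤
      ENNReal.ofReal (ρ ^ ((n : ℝ) + 2 * s)) * gagliardoDensity s u x * volume Q := by
  have hm : Measurable fun y => u x - u y := measurable_const.sub hu
  have h1 := eLpNorm_le_eLpNorm_mul_rpow_measure_univ (p := 1) (q := 2) (μ := volume.restrict Q)
    one_le_two hm.aestronglyMeasurable
  have h2 : eLpNorm (fun y => u x - u y) 2 (volume.restrict Q) ^ 2 ≤
      ENNReal.ofReal (ρ ^ ((n : ℝ) + 2 * s)) * gagliardoDensity s u x := by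
    rw [eLpNorm_two_sq, gagliardoDensity, ← lintegral_const_mul' _ _ ENNReal.ofReal_ne_top]
    refine le_trans ?_ (setLIntegral_le_lintegral Q _)
    refine setLIntegral_mono' hQ fun y hy => ?_
    by_cases hxy : x = y
    · simp [hxy]
    have h0 : 0 < ‖x - y‖ := norm_pos_iff.2 (sub_ne_zero.2 hxy)
    have h3 : 1 ≤ ρ ^ ((n : ℝ) + 2 * s) * ‖x - y‖ ^ (-((n : ℝ) + 2 * s)) := by
      rw [Real.rpow_neg h0.le, ← div_eq_mul_inv, one_le_div (by positivity)]
      exact Real.rpow_le_rpow h0.le (hQρ y hy) (by positivity)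
    calc ‖u x - u y‖ₑ ^ 2 = ‖u x - u y‖ₑ ^ 2 * 1 := (mul_one _).symm
      _ ≤ ‖u x - u y‖ₑ ^ 2 * ENNReal.ofReal
          (ρ ^ ((n : ℝ) + 2 * s) * ‖x - y‖ ^ (-((n : ℝ) + 2 * s))) := by
          gcongr
          exact ENNReal.one_le_ofReal.2 h3
      _ = _ := by
          rw [ENNReal.ofReal_mul (by positivity)]
          ring
  calc eLpNorm (fun y => u x - u y) 1 (volume.restrict Q) ^ 2
      ≤ (eLpNorm (fun y => u x - u y) 2 (volume.restrict Q) * volume Q ^ (1 / 2 : ℝ)) ^ 2 := by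
        gcongr
        refine h1.trans (le_of_eq ?_)
        rw [Measure.restrict_apply_univ]
        norm_num
    _ = eLpNorm (fun y => u x - u y) 2 (volume.restrict Q) ^ 2 * volume Q := by
        rw [mul_pow, ← ENNReal.rpow_natCast (volume Q ^ (1 / 2 : ℝ)), ← ENNReal.rpow_mul]
        norm_num
    _ ≤ _ := by gcongr

/-- The pointwise inequality behind the Sobolev embedding: compare `u x` with the mean of `u` over
the ball about `x` whose volume makes the mean at most `|u x| / 2`. -/
lemma exists_rpow_le_gagliardoDensity (n : ℕ) (s : ℝ) (hs : 0 < s) (hsn : 2 * s < n) :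
    ∃ C : NNReal, ∀ u : EuclideanSpace ℝ (Fin n) → ℝ, Measurable u →
      ∀ p : ℝ, p = 2 * n / (n - 2 * s) →
      eLpNorm u (ENNReal.ofReal p) volume ≠ 0 → eLpNorm u (ENNReal.ofReal p) volume ≠ ⊤ →
      ∀ x, ‖u x‖ₑ ^ p ≤
        C * eLpNorm u (ENNReal.ofReal p) volume ^ (p - 2) * gagliardoDensity s u x := by
  have hn : (0 : ℝ) < n := by linarith
  have hn0 : n ≠ 0 := by
    rintro rfl
    simp at hn
  have : Nonempty (Fin n) := ⟨⟨0, Nat.pos_of_ne_zero hn0⟩⟩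
  set ω : ℝ := (volume (Metric.ball (0 : EuclideanSpace ℝ (Fin n)) 1)).toReal with hω
  have hω0 : 0 < ω := ENNReal.toReal_pos (Metric.measure_ball_pos volume _ one_pos).ne'
    measure_ball_lt_top.ne
  refine ⟨(2 ^ (2 * n / (n - 2 * s)) * (1 / ω) ^ ((n + 2 * s) / n)).toNNReal,
    fun u hu p hp hN0 hNt x => ?_⟩
  rw [← hp]
  have hns : 0 < (n : ℝ) - 2 * s := by linarith
  have hp2 : 2 < p := by
    rw [hp, lt_div_iff₀ hns]
    linarith
  have hps : p - 2 = p * (2 * s / n) := by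
    rw [hp]
    field_simp
    ring
  set N : ℝ := (eLpNorm u (ENNReal.ofReal p) volume).toReal with hN
  have hNpos : 0 < N := ENNReal.toReal_pos hN0 hNt
  have hNe : eLpNorm u (ENNReal.ofReal p) volume = ENNReal.ofReal N :=
    (ENNReal.ofReal_toReal hNt).symm
  by_cases hux : u x = 0
  · rw [hux, enorm_zero, ENNReal.zero_rpow_of_pos (by linarith)]
    exact zero_le
  set a : ℝ := |u x| with ha
  have ha0 : 0 < a := abs_pos.2 hux
  have hae : ‖u x‖ₑ = ENNReal.ofReal a := Real.enorm_eq_ofReal_abs _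
  by_cases hgt : gagliardoDensity s u x = ⊤
  · rw [hgt, ENNReal.mul_top]
    · exact le_top
    · refine mul_ne_zero ?_ ?_
      · simp only [ne_eq, ENNReal.coe_eq_zero, Real.toNNReal_eq_zero, not_le]
        positivity
      · exact (ENNReal.rpow_pos (pos_iff_ne_zero.2 hN0) hNt).ne'
  set g : ℝ := (gagliardoDensity s u x).toReal with hg
  have hge : gagliardoDensity s u x = ENNReal.ofReal g := (ENNReal.ofReal_toReal hgt).symm
  have hg0 : 0 ≤ g := ENNReal.toReal_nonneg
  -- the volume `v` and the radius `r` of the ball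
  set v : ℝ := (2 * N / a) ^ p with hv
  have hv0 : 0 < v := by positivity
  set r : ℝ := (v / ω) ^ (1 / (n : ℝ)) with hr
  have hr0 : 0 < r := by positivity
  have hrn : r ^ n = v / ω := by
    rw [hr, ← Real.rpow_natCast, ← Real.rpow_mul (by positivity), one_div,
      inv_mul_cancel₀ hn.ne', Real.rpow_one]
  have hvol : volume (Metric.ball x r) = ENNReal.ofReal v := by
    rw [Measure.addHaar_ball_of_pos _ _ hr0, finrank_euclideanSpace, Fintype.card_fin, hrn,
      ← ENNReal.ofReal_toReal (measure_ball_lt_top (μ := volume)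
        (x := (0 : EuclideanSpace ℝ (Fin n))) (r := 1)).ne, ← hω,
      ← ENNReal.ofReal_mul (by positivity), div_mul_cancel₀ _ hω0.ne']
  set B := Metric.ball x r with hB
  have hosc := eLpNorm_sub_le_gagliardoDensity hs hu x (Q := B) Metric.isOpen_ball.measurableSet
    hr0.le fun y hy => by
      rw [hB, Metric.mem_ball', dist_eq_norm] at hy
      exact hy.le
  set o : ENNReal := eLpNorm (fun y => u x - u y) 1 (volume.restrict B) with ho
  have hmean : eLpNorm u 1 (volume.restrict B) ≤ ENNReal.ofReal (v * (a / 2)) := by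
    have h1 := eLpNorm_le_eLpNorm_mul_rpow_measure_univ (p := 1) (q := ENNReal.ofReal p)
      (μ := volume.restrict B) (by
        rw [ENNReal.one_le_ofReal]
        linarith) hu.aestronglyMeasurable
    refine h1.trans ?_
    rw [Measure.restrict_apply_univ, hvol, ENNReal.toReal_one,
      ENNReal.toReal_ofReal (by linarith : 0 ≤ p)]
    calc eLpNorm u (ENNReal.ofReal p) (volume.restrict B) * ENNReal.ofReal v ^ (1 / 1 - 1 / p)
        ≤ ENNReal.ofReal N * ENNReal.ofReal v ^ (1 / 1 - 1 / p) := by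
          gcongr
          rw [← hNe]
          exact eLpNorm_mono_measure _ Measure.restrict_le_self
      _ = ENNReal.ofReal (v * (a / 2)) := by
          rw [ENNReal.ofReal_rpow_of_pos hv0, ← ENNReal.ofReal_mul hNpos.le]
          congr 1
          rw [Real.rpow_sub hv0, div_one, Real.rpow_one, hv, ← Real.rpow_mul (by positivity),
            mul_one_div_cancel (by linarith), Real.rpow_one, ← hv]
          field_simp
  have htri : ENNReal.ofReal (a * v) ≤ o + ENNReal.ofReal (v * (a / 2)) := by
    have h1 : eLpNorm (fun _ : EuclideanSpace ℝ (Fin n) => u x) 1 (volume.restrict B) =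
        ENNReal.ofReal (a * v) := by
      rw [eLpNorm_one_eq_lintegral_enorm, lintegral_const, Measure.restrict_apply_univ, hvol, hae,
        ENNReal.ofReal_mul ha0.le]
    rw [← h1]
    have h2 := eLpNorm_add_le (p := 1) (μ := volume.restrict B)
      (f := fun y => u x - u y) (g := u) (measurable_const.sub hu).aestronglyMeasurable
      hu.aestronglyMeasurable le_rfl
    refine le_trans (le_of_eq ?_) (h2.trans (add_le_add le_rfl hmean))
    congr 1
    ext y
    simp
  have hotop : o ≠ ⊤ := by
    intro h
    rw [h, hge, hvol] at hosc
    simp only [ne_eq, OfNat.ofNat_ne_zero, not_false_eq_true, ENNReal.top_pow, top_le_iff] at hosc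
    exact ENNReal.mul_ne_top (ENNReal.mul_ne_top ENNReal.ofReal_ne_top ENNReal.ofReal_ne_top)
      ENNReal.ofReal_ne_top hosc
  obtain ⟨b, hb0, hbo⟩ : ∃ b : ℝ, 0 ≤ b ∧ o = ENNReal.ofReal b :=
    ⟨o.toReal, ENNReal.toReal_nonneg, (ENNReal.ofReal_toReal hotop).symm⟩
  rw [hbo, ← ENNReal.ofReal_add hb0 (by positivity),
    ENNReal.ofReal_le_ofReal_iff (by positivity)] at htri
  rw [hbo, hge, hvol, ← ENNReal.ofReal_pow hb0, ← ENNReal.ofReal_mul (by positivity),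
    ← ENNReal.ofReal_mul (by positivity), ENNReal.ofReal_le_ofReal_iff (by positivity)] at hosc
  have hfin : v * a ^ 2 ≤ 4 * r ^ ((n : ℝ) + 2 * s) * g := by
    have h1 : v * (a / 2) ≤ b := by linarith
    have h2 : (v * (a / 2)) ^ 2 ≤ b ^ 2 := by gcongr
    have h3 : v * a ^ 2 * v ≤ 4 * r ^ ((n : ℝ) + 2 * s) * g * v := by nlinarith
    exact le_of_mul_le_mul_right h3 hv0
  have hr2 : r ^ ((n : ℝ) + 2 * s) = v * (2 * N / a) ^ (p - 2) * (1 / ω) ^ ((n + 2 * s) / n) := by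
    rw [hr, ← Real.rpow_mul (by positivity), div_eq_mul_one_div v, Real.mul_rpow (by positivity)
      (by positivity), one_div_mul_eq_div, hps, Real.rpow_mul (by positivity), ← hv, add_div,
      div_self hn.ne', Real.rpow_add hv0, Real.rpow_one]
  rw [hr2] at hfin
  have hfin2 : a ^ p ≤ 2 ^ p * (1 / ω) ^ ((n + 2 * s) / n) * N ^ (p - 2) * g := by
    have h1 : a ^ 2 ≤ 4 * (2 * N / a) ^ (p - 2) * (1 / ω) ^ ((n + 2 * s) / n) * g := by
      refine le_of_mul_le_mul_left ?_ hv0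
      linarith
    have h2 : a ^ p = a ^ 2 * a ^ (p - 2) := by
      rw [← Real.rpow_natCast, ← Real.rpow_add ha0]
      norm_num
    have h3 : (2 : ℝ) ^ p = 4 * 2 ^ (p - 2) := by
      rw [show p = 2 + (p - 2) by ring, Real.rpow_add two_pos]
      norm_num
    rw [h2, h3]
    calc a ^ 2 * a ^ (p - 2)
        ≤ 4 * (2 * N / a) ^ (p - 2) * (1 / ω) ^ ((n + 2 * s) / n) * g * a ^ (p - 2) := by gcongr
      _ = _ := by
        rw [Real.div_rpow (by positivity) ha0.le, Real.mul_rpow two_pos.le hNpos.le]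
        have : a ^ (p - 2) ≠ 0 := (Real.rpow_pos_of_pos ha0 _).ne'
        field_simp
  rw [hae, hNe, hge, ENNReal.ofReal_rpow_of_pos ha0, ENNReal.ofReal_rpow_of_pos hNpos,
    ← ENNReal.ofReal.eq_1, ← ENNReal.ofReal_mul (by positivity), ← ENNReal.ofReal_mul (by positivity)]
  exact ENNReal.ofReal_le_ofReal hfin2

lemma gagliardoDensity_mono {v : EuclideanSpace ℝ (Fin n) → ℝ}
    (h : ∀ x y, |v x - v y| ≤ |u x - u y|) (x : EuclideanSpace ℝ (Fin n)) :
    gagliardoDensity s v x ≤ gagliardoDensity s u x := by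
  refine lintegral_mono fun y => ?_
  gcongr
  rw [Real.enorm_eq_ofReal_abs, Real.enorm_eq_ofReal_abs]
  exact ENNReal.ofReal_le_ofReal (h x y)

/-- The fractional Sobolev inequality in `ℝⁿ`. -/
theorem exists_sobolev (n : ℕ) (s : ℝ) (hs : 0 < s) (hsn : 2 * s < n) :
    ∃ C : NNReal, ∀ u : EuclideanSpace ℝ (Fin n) → ℝ, Measurable u → MemLp u 2 volume →
      eLpNorm u (ENNReal.ofReal (2 * n / (n - 2 * s))) volume ^ 2 ≤
        C * ∫⁻ x, gagliardoDensity s u x := by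
  obtain ⟨C, hC⟩ := exists_rpow_le_gagliardoDensity n s hs hsn
  set p : ℝ := 2 * n / (n - 2 * s) with hp
  have hp2 : 2 < p := by
    rw [hp, lt_div_iff₀ (by linarith)]
    linarith
  have hp0 : ENNReal.ofReal p ≠ 0 := by
    simp only [ne_eq, ENNReal.ofReal_eq_zero, not_le]
    linarith
  have hpr : (ENNReal.ofReal p).toReal = p := ENNReal.toReal_ofReal (by linarith)
  have hfin : ∀ u : EuclideanSpace ℝ (Fin n) → ℝ, Measurable u →
      eLpNorm u (ENNReal.ofReal p) volume ≠ ⊤ →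
      eLpNorm u (ENNReal.ofReal p) volume ^ 2 ≤ C * ∫⁻ x, gagliardoDensity s u x := by
    intro u hu hNt
    set N := eLpNorm u (ENNReal.ofReal p) volume with hN
    by_cases hN0 : N = 0
    · rw [hN0]; simp
    have h1 : N ^ p ≤ C * N ^ (p - 2) * ∫⁻ x, gagliardoDensity s u x := by
      have h2 : N ^ p = ∫⁻ x, ‖u x‖ₑ ^ p := by
        rw [hN, eLpNorm_eq_lintegral_rpow_enorm_toReal hp0 ENNReal.ofReal_ne_top, hpr,
          ← ENNReal.rpow_mul, one_div, inv_mul_cancel₀ (by linarith), ENNReal.rpow_one]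
      rw [h2, ← lintegral_const_mul' _ _ (ENNReal.mul_ne_top ENNReal.coe_ne_top
        (ENNReal.rpow_ne_top_of_nonneg (by linarith) hNt))]
      exact lintegral_mono (hC u hu p rfl hN0 hNt)
    have h3 : N ^ p = N ^ (p - 2) * N ^ 2 := by
      rw [← ENNReal.rpow_natCast, ← ENNReal.rpow_add _ _ hN0 hNt]
      norm_num
    have h4 : N ^ (p - 2) ≠ 0 := (ENNReal.rpow_pos (pos_iff_ne_zero.2 hN0) hNt).ne'
    have h5 : N ^ (p - 2) ≠ ⊤ := ENNReal.rpow_ne_top_of_nonneg (by linarith) hNt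
    rw [h3, mul_comm (C : ENNReal), mul_assoc] at h1
    exact (ENNReal.mul_le_mul_iff_right h4 h5).1 h1
  refine ⟨C, fun u hu hu2 => ?_⟩
  -- truncate at height `j`, where the norm is finite, and let `j → ∞`
  set w : ℕ → EuclideanSpace ℝ (Fin n) → ℝ := fun j x => max (-j) (min (u x) j) with hw
  have hwm : ∀ j, Measurable (w j) := fun j => measurable_const.max (hu.min measurable_const)
  have hwj : ∀ j x, |w j x| ≤ j := fun j x => by
    rw [abs_le]
    refine ⟨le_max_left _ _, max_le ?_ (min_le_right _ _)⟩
    have : (0 : ℝ) ≤ j := Nat.cast_nonneg j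
    linarith
  have hwu : ∀ j x y, |w j x - w j y| ≤ |u x - u y| := fun j x y => by
    refine (abs_max_sub_max_le_max _ _ _ _).trans ?_
    rw [sub_self, abs_zero, max_eq_right (abs_nonneg _)]
    refine (abs_min_sub_min_le_max _ _ _ _).trans ?_
    rw [sub_self, abs_zero, max_eq_left (abs_nonneg _)]
  have hwu0 : ∀ j x, |w j x| ≤ |u x| := fun j x => by
    have h0 : max (-(j : ℝ)) (min 0 (j : ℝ)) = 0 := by simp
    have h1 : |w j x - max (-(j : ℝ)) (min 0 (j : ℝ))| ≤ |u x - 0| := by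
      refine (abs_max_sub_max_le_max _ _ _ _).trans ?_
      rw [sub_self, abs_zero, max_eq_right (abs_nonneg _)]
      refine (abs_min_sub_min_le_max _ _ _ _).trans ?_
      rw [sub_self, abs_zero, max_eq_left (abs_nonneg _)]
    rwa [h0, sub_zero, sub_zero] at h1
  have hwt : ∀ j, eLpNorm (w j) (ENNReal.ofReal p) volume ≠ ⊤ := fun j => by
    rw [← lt_top_iff_ne_top]
    refine (eLpNorm_lt_top_iff_lintegral_rpow_enorm_lt_top hp0 ENNReal.ofReal_ne_top).2 ?_
    rw [hpr]
    have h1 : ∀ x, ‖w j x‖ₑ ^ p ≤ ENNReal.ofReal ((j : ℝ) ^ (p - 2)) * ‖u x‖ₑ ^ 2 := fun x => by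
      rw [Real.enorm_eq_ofReal_abs, Real.enorm_eq_ofReal_abs,
        ENNReal.ofReal_rpow_of_nonneg (abs_nonneg _) (by linarith),
        ← ENNReal.ofReal_pow (abs_nonneg _), ← ENNReal.ofReal_mul (by positivity)]
      refine ENNReal.ofReal_le_ofReal ?_
      rcases (abs_nonneg (w j x)).eq_or_lt with h | h
      · rw [← h, Real.zero_rpow (by linarith)]
        positivity
      · calc |w j x| ^ p = |w j x| ^ (p - 2) * |w j x| ^ 2 := by
              rw [← Real.rpow_natCast, ← Real.rpow_add h]
              norm_num
          _ ≤ _ := by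
              exact mul_le_mul (Real.rpow_le_rpow (abs_nonneg _) (hwj j x) (by linarith))
                (pow_le_pow_left₀ (abs_nonneg _) (hwu0 j x) 2) (by positivity) (by positivity)
    refine (lintegral_mono h1).trans_lt ?_
    rw [lintegral_const_mul' _ _ ENNReal.ofReal_ne_top, ← eLpNorm_two_sq]
    exact ENNReal.mul_lt_top ENNReal.ofReal_lt_top (ENNReal.pow_lt_top hu2.2)
  have hbd : ∀ j, eLpNorm (w j) (ENNReal.ofReal p) volume ≤
      (C * ∫⁻ x, gagliardoDensity s u x) ^ (1 / 2 : ℝ) := fun j => by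
    have h1 := (hfin (w j) (hwm j) (hwt j)).trans
      (mul_le_mul_right (lintegral_mono (gagliardoDensity_mono (s := s) (hwu j))) _)
    have h2 := ENNReal.rpow_le_rpow h1 (by norm_num : (0 : ℝ) ≤ 1 / 2)
    rwa [← ENNReal.rpow_natCast, ← ENNReal.rpow_mul, show ((2 : ℕ) : ℝ) * (1 / 2) = 1 by norm_num,
      ENNReal.rpow_one] at h2
  have hlim : ∀ x, Tendsto (fun j => w j x) atTop (𝓝 (u x)) := fun x => by
    refine tendsto_const_nhds.congr' ?_
    filter_upwards [eventually_ge_atTop ⌈|u x|⌉₊] with j hj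
    have h1 : |u x| ≤ j := (Nat.le_ceil _).trans (Nat.cast_le.2 hj)
    rw [abs_le] at h1
    simp only [hw]
    rw [min_eq_left h1.2, max_eq_right h1.1]
  have h1 := Lp.eLpNorm_lim_le_liminf_eLpNorm (p := ENNReal.ofReal p) (μ := volume) (f := w)
    (fun j => (hwm j).aestronglyMeasurable) u (Eventually.of_forall hlim)
  have h2 : eLpNorm u (ENNReal.ofReal p) volume ≤
      (C * ∫⁻ x, gagliardoDensity s u x) ^ (1 / 2 : ℝ) :=
    h1.trans (liminf_le_of_le (by isBoundedDefault) fun b hb => by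
      obtain ⟨j, hj⟩ := hb.exists
      exact hj.trans (hbd j))
  calc eLpNorm u (ENNReal.ofReal p) volume ^ 2
      ≤ ((C * ∫⁻ x, gagliardoDensity s u x) ^ (1 / 2 : ℝ)) ^ 2 := by gcongr
    _ = _ := by
      rw [← ENNReal.rpow_natCast, ← ENNReal.rpow_mul, show (1 / 2 : ℝ) * (2 : ℕ) = 1 by norm_num,
        ENNReal.rpow_one]

/-! ### Means over cubes -/

/-- The half-open cube of side `h` with index `κ` in the grid of side `h`. -/
def gridCube (h : ℝ) (κ : Fin n → ℤ) : Set (EuclideanSpace ℝ (Fin n)) :=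
  {x | ∀ i, x i ∈ Set.Ico (h * κ i) (h * κ i + h)}

lemma mem_gridCube_iff {h : ℝ} (hh : 0 < h) {κ : Fin n → ℤ} {x : EuclideanSpace ℝ (Fin n)} :
    x ∈ gridCube h κ ↔ (fun i => ⌊x i / h⌋) = κ := by
  simp only [gridCube, Set.mem_ofPred_eq, Set.mem_Ico, funext_iff, Int.floor_eq_iff,
    le_div_iff₀ hh, div_lt_iff₀ hh]
  refine forall_congr' fun i => ?_
  rw [mul_comm h, add_mul, one_mul]

lemma gridCube_eq_preimage (h : ℝ) (κ : Fin n → ℤ) :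
    gridCube h κ = (WithLp.ofLp : EuclideanSpace ℝ (Fin n) → Fin n → ℝ) ⁻¹'
      (Set.univ.pi fun i => Set.Ico (h * κ i) (h * κ i + h)) := by
  ext x
  simp [gridCube, Set.mem_pi]

lemma measurableSet_gridCube (h : ℝ) (κ : Fin n → ℤ) : MeasurableSet (gridCube h κ) := by
  rw [gridCube_eq_preimage]
  exact (PiLp.volume_preserving_ofLp (Fin n)).measurable
    (MeasurableSet.univ_pi fun i => measurableSet_Ico)

lemma volume_gridCube {h : ℝ} (hh : 0 < h) (κ : Fin n → ℤ) :
    volume (gridCube h κ) = ENNReal.ofReal (h ^ n) := by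
  rw [gridCube_eq_preimage, (PiLp.volume_preserving_ofLp (Fin n)).measure_preimage
    (MeasurableSet.univ_pi fun i => measurableSet_Ico).nullMeasurableSet, Real.volume_pi_Ico]
  simp [ENNReal.ofReal_pow hh.le]

lemma norm_sub_le_of_mem_gridCube {h : ℝ} (hh : 0 < h) {κ : Fin n → ℤ}
    {x y : EuclideanSpace ℝ (Fin n)} (hx : x ∈ gridCube h κ) (hy : y ∈ gridCube h κ) :
    ‖x - y‖ ≤ √n * h := by
  rw [EuclideanSpace.norm_eq, ← Real.sqrt_sq hh.le, ← Real.sqrt_mul (Nat.cast_nonneg n)]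
  refine Real.sqrt_le_sqrt ?_
  calc ∑ i, ‖(x - y) i‖ ^ 2 ≤ ∑ _i : Fin n, h ^ 2 := by
        refine Finset.sum_le_sum fun i _ => ?_
        have h1 := hx i
        have h2 := hy i
        rw [Set.mem_Ico] at h1 h2
        have h3 : |x i - y i| ≤ h := by
          rw [abs_le]
          constructor <;> linarith
        rw [Real.norm_eq_abs, PiLp.sub_apply]
        gcongr
    _ = n * h ^ 2 := by simp

/-- A function differs from its mean over a grid cube by `O(h^s)` times the square root of the
Gagliardo density. -/
lemma enorm_sub_mean_gridCube_sq_le (hs : 0 < s) (hu : Measurable u) (hu2 : MemLp u 2 volume)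
    {h : ℝ} (hh : 0 < h) {κ : Fin n → ℤ} {x : EuclideanSpace ℝ (Fin n)} (hx : x ∈ gridCube h κ) :
    ‖u x - (h ^ n)⁻¹ * ∫ y in gridCube h κ, u y‖ₑ ^ 2 ≤
      ENNReal.ofReal (√n ^ ((n : ℝ) + 2 * s) * h ^ (2 * s)) * gagliardoDensity s u x := by
  set Q := gridCube h κ with hQ
  have hhn : 0 < h ^ n := by positivity
  have hvol : volume Q = ENNReal.ofReal (h ^ n) := volume_gridCube hh κ
  have hosc := eLpNorm_sub_le_gagliardoDensity hs hu x (measurableSet_gridCube h κ)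
    (ρ := √n * h) (by positivity) fun y hy => norm_sub_le_of_mem_gridCube hh hx hy
  rw [← hQ, hvol] at hosc
  have hfm : IsFiniteMeasure (volume.restrict Q) := ⟨by
    rw [Measure.restrict_apply_univ, hvol]
    exact ENNReal.ofReal_lt_top⟩
  have hint : Integrable u (volume.restrict Q) := (hu2.restrict Q).integrable one_le_two
  have h1 : u x - (h ^ n)⁻¹ * ∫ y in Q, u y = (h ^ n)⁻¹ * ∫ y in Q, (u x - u y) := by
    rw [integral_sub (integrable_const _) hint, integral_const, smul_eq_mul, measureReal_def,
      Measure.restrict_apply_univ, hvol, ENNReal.toReal_ofReal hhn.le]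
    field_simp
  have h2 : ‖∫ y in Q, (u x - u y)‖ₑ ≤ eLpNorm (fun y => u x - u y) 1 (volume.restrict Q) := by
    rw [eLpNorm_one_eq_lintegral_enorm]
    exact enorm_integral_le_lintegral_enorm _
  rw [h1, enorm_mul, mul_pow, Real.enorm_eq_ofReal (by positivity), ← ENNReal.ofReal_pow
    (by positivity)]
  calc ENNReal.ofReal ((h ^ n)⁻¹ ^ 2) * ‖∫ y in Q, (u x - u y)‖ₑ ^ 2
      ≤ ENNReal.ofReal ((h ^ n)⁻¹ ^ 2) * (ENNReal.ofReal ((√n * h) ^ ((n : ℝ) + 2 * s)) *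
          gagliardoDensity s u x * ENNReal.ofReal (h ^ n)) := by
        gcongr
        exact le_trans (by gcongr) hosc
    _ = ENNReal.ofReal ((h ^ n)⁻¹ ^ 2 * (√n * h) ^ ((n : ℝ) + 2 * s) * h ^ n) *
          gagliardoDensity s u x := by
        rw [ENNReal.ofReal_mul (by positivity), ENNReal.ofReal_mul (by positivity)]
        ring
    _ = _ := by
        congr 2
        rw [Real.mul_rpow (by positivity) hh.le, Real.rpow_add hh, Real.rpow_natCast]
        field_simp

end Gagliardo

namespace NonlocalSetting

variable {S : NonlocalSetting}

/-! ### The embeddings of `X₀` -/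

lemma finite_restrict (S : NonlocalSetting) : IsFiniteMeasure (volume.restrict S.Ω) :=
  ⟨by
    rw [Measure.restrict_apply_univ]
    exact S.isBounded_Ω.measure_lt_top⟩

attribute [local instance] finite_restrict

lemma X0.measurable (u : S.X0) : Measurable u := (AEEqFun.stronglyMeasurable u.1).measurable

lemma X0.eLpNorm_diffq (u : S.X0) : eLpNorm (S.diffq u) 2 volume = ENNReal.ofReal ‖u‖ := by
  rw [X0.norm_eq, show S.toL2 u = u.memLp_diffq.toLp from rfl, Lp.norm_toLp,
    ENNReal.ofReal_toReal u.memLp_diffq.2.ne]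

/-- The lower bound on the kernel makes the norm of `X₀` stronger than the Gagliardo seminorm. -/
lemma exists_lintegral_gagliardoDensity_le (S : NonlocalSetting) : ∃ C : NNReal, ∀ u : S.X0,
    ∫⁻ x, gagliardoDensity S.s u x ≤ C * ENNReal.ofReal ‖u‖ ^ 2 := by
  obtain ⟨θ, hθ, hK⟩ := S.K_lower
  refine ⟨(θ⁻¹).toNNReal, fun u => ?_⟩
  have hm : AEMeasurable (fun p : S.E × S.E => ‖S.diffq u p‖ₑ ^ 2) (volume.prod volume) := by
    rw [← Measure.volume_eq_prod]
    exact (u.memLp_diffq.1.enorm).pow_const 2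
  rw [← X0.eLpNorm_diffq, eLpNorm_two_sq, Measure.volume_eq_prod, lintegral_prod _ hm,
    ← lintegral_const_mul' _ _ ENNReal.coe_ne_top]
  refine lintegral_mono fun x => ?_
  rw [gagliardoDensity, ← lintegral_const_mul' _ _ ENNReal.coe_ne_top]
  refine lintegral_mono fun y => ?_
  by_cases hxy : x = y
  · simp [hxy]
  have h0 := hK (x - y) (sub_ne_zero.2 hxy)
  have hK0 : 0 ≤ S.K (x - y) := (S.K_pos _ (sub_ne_zero.2 hxy)).le
  simp only [diffq, enorm_mul, mul_pow]
  rw [Real.enorm_eq_ofReal (Real.sqrt_nonneg _), ← ENNReal.ofReal_pow (Real.sqrt_nonneg _),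
    Real.sq_sqrt hK0, mul_left_comm]
  gcongr
  rw [← ENNReal.ofReal.eq_1, ← ENNReal.ofReal_mul (by positivity)]
  refine ENNReal.ofReal_le_ofReal ?_
  rw [inv_mul_eq_div, le_div_iff₀ hθ, mul_comm]
  exact h0

/-- The critical Sobolev exponent `2n / (n - 2s)`. -/
noncomputable def critExp (S : NonlocalSetting) : ℝ := 2 * S.n / (S.n - 2 * S.s)

lemma two_lt_critExp (S : NonlocalSetting) : 2 < S.critExp := by
  have := S.s_pos
  have := S.two_s_lt
  rw [critExp, lt_div_iff₀ (by linarith)]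
  linarith

/-- The embedding of `X₀` into `L^p(Ω)` up to the critical exponent. -/
lemma exists_eLpNorm_le (S : NonlocalSetting) {p : ENNReal}
    (hp : p ≤ ENNReal.ofReal S.critExp) : ∃ C : NNReal, ∀ u : S.X0,
      eLpNorm u p (volume.restrict S.Ω) ≤ C * ENNReal.ofReal ‖u‖ := by
  obtain ⟨C₁, h₁⟩ := exists_sobolev S.n S.s S.s_pos S.two_s_lt
  obtain ⟨C₂, h₂⟩ := S.exists_lintegral_gagliardoDensity_le
  have hcrit : ∀ u : S.X0, eLpNorm u (ENNReal.ofReal S.critExp) (volume.restrict S.Ω) ≤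
      NNReal.sqrt (C₁ * C₂) * ENNReal.ofReal ‖u‖ := by
    intro u
    refine (eLpNorm_mono_measure _ Measure.restrict_le_self).trans ?_
    refine (ENNReal.pow_le_pow_left_iff two_ne_zero).1 ?_
    refine (h₁ u u.measurable u.memLp).trans ?_
    rw [mul_pow, ← ENNReal.coe_pow, NNReal.sq_sqrt, ENNReal.coe_mul, mul_assoc]
    gcongr
    exact h₂ u
  by_cases hp0 : p = 0
  · exact ⟨0, fun u => by simp [hp0]⟩
  set V : ENNReal := (volume.restrict S.Ω) Set.univ ^
    (1 / p.toReal - 1 / (ENNReal.ofReal S.critExp).toReal) with hV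
  have hVt : V ≠ ⊤ := by
    refine ENNReal.rpow_ne_top_of_nonneg ?_ (measure_ne_top _ _)
    rw [sub_nonneg]
    exact one_div_le_one_div_of_le
      (ENNReal.toReal_pos hp0 (hp.trans_lt ENNReal.ofReal_lt_top).ne)
      (ENNReal.toReal_mono ENNReal.ofReal_ne_top hp)
  refine ⟨NNReal.sqrt (C₁ * C₂) * V.toNNReal, fun u => ?_⟩
  refine (eLpNorm_le_eLpNorm_mul_rpow_measure_univ hp
    u.measurable.aestronglyMeasurable).trans ?_
  rw [ENNReal.coe_mul, ENNReal.coe_toNNReal hVt, mul_right_comm]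
  gcongr
  exact hcrit u

lemma X0.memLp_of_le (u : S.X0) {p : ENNReal} (hp : p ≤ ENNReal.ofReal S.critExp) :
    MemLp u p (volume.restrict S.Ω) := by
  obtain ⟨C, hC⟩ := S.exists_eLpNorm_le hp
  exact ⟨u.measurable.aestronglyMeasurable,
    (hC u).trans_lt (ENNReal.mul_lt_top ENNReal.coe_lt_top ENNReal.ofReal_lt_top)⟩

variable (S) in
/-- The embedding `X₀ → L^p(Ω)`, where `1 ≤ p ≤ 2n / (n - 2s)`. -/
noncomputable def embed (p : ENNReal) [Fact (1 ≤ p)] (hp : p ≤ ENNReal.ofReal S.critExp) :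
    S.X0 →L[ℝ] Lp ℝ p (volume.restrict S.Ω) :=
  LinearMap.mkContinuousOfExistsBound
    { toFun := fun u => (u.memLp_of_le hp).toLp
      map_add' := fun u v => by
        rw [← MemLp.toLp_add]
        exact MemLp.toLp_congr _ _ (ae_restrict_of_ae (AEEqFun.coeFn_add u.1 v.1))
      map_smul' := fun c u => by
        rw [RingHom.id_apply, ← MemLp.toLp_const_smul]
        exact MemLp.toLp_congr _ _ (ae_restrict_of_ae (AEEqFun.coeFn_smul c u.1)) } <| by
    obtain ⟨C, hC⟩ := S.exists_eLpNorm_le hp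
    refine ⟨C, fun u => ?_⟩
    simp only [LinearMap.coe_mk, AddHom.coe_mk, Lp.norm_toLp]
    refine ENNReal.toReal_le_of_le_ofReal (by positivity) ((hC u).trans (le_of_eq ?_))
    rw [ENNReal.ofReal_mul C.coe_nonneg, ENNReal.ofReal_coe_nnreal]

section

variable {p : ENNReal} [Fact (1 ≤ p)] (hp : p ≤ ENNReal.ofReal S.critExp)

lemma coeFn_embed (u : S.X0) : S.embed p hp u =ᵐ[volume.restrict S.Ω] u :=
  (u.memLp_of_le hp).coeFn_toLp

lemma norm_embed (u : S.X0) :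
    ‖S.embed p hp u‖ = (eLpNorm u p (volume.restrict S.Ω)).toReal :=
  Lp.norm_toLp _ (u.memLp_of_le hp)

lemma X0.eq_zero_of_ae {u : S.X0} (h : ∀ᵐ x ∂(volume.restrict S.Ω), u x = 0) : u = 0 := by
  refine Subtype.ext (AEEqFun.ext ?_)
  refine EventuallyEq.trans ?_ AEEqFun.coeFn_zero.symm
  filter_upwards [(ae_restrict_iff' S.isOpen_Ω.measurableSet).1 h, u.ae_eq_zero] with x h1 h2
  by_cases hx : x ∈ S.Ω
  · exact h1 hx
  · exact h2 hx

end

lemma two_le_critExp (S : NonlocalSetting) : 2 ≤ ENNReal.ofReal S.critExp := by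
  rw [← ENNReal.ofReal_ofNat]
  exact ENNReal.ofReal_le_ofReal S.two_lt_critExp.le

variable (S) in
/-- The embedding `X₀ → L²(Ω)`. -/
noncomputable def embedTwo : S.X0 →L[ℝ] Lp ℝ 2 (volume.restrict S.Ω) := S.embed 2 S.two_le_critExp

lemma inner_embedTwo (u v : S.X0) :
    inner ℝ (S.embedTwo u) (S.embedTwo v) = ∫ x in S.Ω, u x * v x := by
  rw [L2.inner_def]
  refine integral_congr_ae ?_
  filter_upwards [coeFn_embed S.two_le_critExp u, coeFn_embed S.two_le_critExp v] with x h1 h2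
  rw [embedTwo, h1, h2]
  simp [mul_comm]

/-! ### Compactness of the embeddings -/

variable (S) in
/-- The averaging operator over the grid cubes of side `h` with index in the finite set `A`. -/
noncomputable def cubeMean (h : ℝ) (A : Finset (Fin S.n → ℤ)) :
    Lp ℝ 2 (volume.restrict S.Ω) →L[ℝ] Lp ℝ 2 (volume.restrict S.Ω) :=
  ∑ κ ∈ A, (h ^ S.n)⁻¹ •
    (innerSL ℝ (indicatorConstLp 2 (measurableSet_gridCube h κ)
      (measure_ne_top (volume.restrict S.Ω) _) (1 : ℝ))).smulRight
    (indicatorConstLp 2 (measurableSet_gridCube h κ)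
      (measure_ne_top (volume.restrict S.Ω) _) (1 : ℝ))

lemma isCompactOperator_cubeMean (h : ℝ) (A : Finset (Fin S.n → ℤ)) :
    IsCompactOperator (S.cubeMean h A) := by
  classical
  have h1 : ∀ (φ : Lp ℝ 2 (volume.restrict S.Ω) →L[ℝ] ℝ) (w : Lp ℝ 2 (volume.restrict S.Ω)),
      IsCompactOperator (φ.smulRight w) := by
    intro φ w
    have h2 : IsCompactOperator (ContinuousLinearMap.toSpanSingleton ℝ w) :=
      isCompactOperator_of_locallyCompactSpace_rng _
    exact h2.comp_clm φ
  unfold cubeMean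
  induction A using Finset.induction_on with
  | empty =>
    rw [Finset.sum_empty]
    exact isCompactOperator_zero
  | insert κ A hκ ih =>
    rw [Finset.sum_insert hκ]
    exact ((h1 _ _).smul ((h ^ S.n)⁻¹)).add ih

lemma setIntegral_restrict_gridCube (u : S.X0) (h : ℝ) (κ : Fin S.n → ℤ) :
    ∫ x in gridCube h κ, u x ∂(volume.restrict S.Ω) = ∫ x in gridCube h κ, u x := by
  rw [Measure.restrict_restrict (measurableSet_gridCube h κ),
    setIntegral_eq_of_subset_of_ae_sdiff_eq_zero
      (measurableSet_gridCube h κ).nullMeasurableSet Set.inter_subset_left]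
  filter_upwards [u.ae_eq_zero] with x hx hxm
  exact hx fun h => hxm.2 ⟨hxm.1, h⟩

lemma cubeMean_ae (u : S.X0) {h : ℝ} (hh : 0 < h) (A : Finset (Fin S.n → ℤ)) :
    ∀ᵐ x ∂(volume.restrict S.Ω), ∀ κ ∈ A, x ∈ gridCube h κ →
      S.cubeMean h A (S.embedTwo u) x = (h ^ S.n)⁻¹ * ∫ y in gridCube h κ, u y := by
  set μ := volume.restrict S.Ω with hμ
  set χ : (Fin S.n → ℤ) → Lp ℝ 2 μ := fun κ => indicatorConstLp 2 (measurableSet_gridCube h κ)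
      (measure_ne_top μ _) (1 : ℝ) with hχ
  set m : (Fin S.n → ℤ) → ℝ := fun κ => (h ^ S.n)⁻¹ * ∫ y in gridCube h κ, u y with hm
  have e1 : S.cubeMean h A (S.embedTwo u) = ∑ κ ∈ A, m κ • χ κ := by
    rw [cubeMean, sum_apply]
    refine Finset.sum_congr rfl fun κ _ => ?_
    rw [smul_apply, ContinuousLinearMap.smulRight_apply, innerSL_apply_apply,
      L2.inner_indicatorConstLp_one, smul_smul]
    congr 2
    rw [← setIntegral_restrict_gridCube]
    exact integral_congr_ae (ae_restrict_of_ae (coeFn_embed S.two_le_critExp u))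
  have e2 : (∑ κ ∈ A, m κ • χ κ : Lp ℝ 2 μ) =ᵐ[μ] ∑ κ ∈ A, ((m κ • χ κ : Lp ℝ 2 μ) : S.E → ℝ) :=
    Lp.coeFn_finsetSum _ _
  have e3 : ∀ᵐ x ∂μ, ∀ κ ∈ A, (m κ • χ κ : Lp ℝ 2 μ) x =
      m κ * (gridCube h κ).indicator (fun _ => (1 : ℝ)) x := by
    refine (Finset.eventually_all A).2 fun κ _ => ?_
    filter_upwards [Lp.coeFn_smul (m κ) (χ κ), indicatorConstLp_coeFn (p := 2)
      (hs := measurableSet_gridCube h κ) (hμs := measure_ne_top μ _) (c := (1 : ℝ))] with x h1 h2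
    rw [h1, Pi.smul_apply, hχ, h2, smul_eq_mul]
  filter_upwards [e2, e3] with x h2 h3 κ hκ hx
  rw [e1, h2, Finset.sum_apply, Finset.sum_eq_single_of_mem κ hκ]
  · rw [h3 κ hκ, Set.indicator_of_mem hx, mul_one]
  · intro κ' hκ' hne
    rw [h3 κ' hκ', Set.indicator_of_notMem, mul_zero]
    intro hx'
    exact hne (((mem_gridCube_iff hh).1 hx').symm.trans ((mem_gridCube_iff hh).1 hx))

/-- The embedding of `X₀` into `L²(Ω)` is compact: it is the limit in operator norm of averages over
finitely many grid cubes. -/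
lemma isCompactOperator_embedTwo (S : NonlocalSetting) : IsCompactOperator S.embedTwo := by
  obtain ⟨C, hC⟩ := S.exists_lintegral_gagliardoDensity_le
  obtain ⟨R, hR0, hR⟩ := S.isBounded_Ω.subset_closedBall_lt 0 0
  set M : ℝ := √S.n ^ ((S.n : ℝ) + 2 * S.s) * C with hM
  have hM0 : 0 ≤ M := by positivity
  have hfin : ∀ h : ℝ, 0 < h → ∃ A : Finset (Fin S.n → ℤ),
      ‖S.cubeMean h A ∘L S.embedTwo - S.embedTwo‖ ≤ √(M * h ^ (2 * S.s)) := by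
    intro h hh
    refine ⟨Fintype.piFinset fun _ => Finset.Icc ⌊-R / h⌋ ⌊R / h⌋,
      ContinuousLinearMap.opNorm_le_bound _ (Real.sqrt_nonneg _) fun u => ?_⟩
    set A := Fintype.piFinset fun _ : Fin S.n => Finset.Icc ⌊-R / h⌋ ⌊R / h⌋ with hA
    have hmem : ∀ x ∈ S.Ω, (fun i => ⌊x i / h⌋) ∈ A := by
      intro x hx
      rw [hA, Fintype.mem_piFinset]
      intro i
      have h1 : |x i| ≤ R := by
        have h2 : ‖x‖ ≤ R := by simpa using hR hx
        exact (PiLp.norm_apply_le x i).trans h2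
      rw [abs_le] at h1
      rw [Finset.mem_Icc]
      exact ⟨Int.floor_le_floor (by gcongr; exact h1.1), Int.floor_le_floor (by gcongr; exact h1.2)⟩
    have hpt : ∀ᵐ x ∂(volume.restrict S.Ω),
        ‖(S.cubeMean h A (S.embedTwo u) - S.embedTwo u : Lp ℝ 2 (volume.restrict S.Ω)) x‖ₑ ^ 2 ≤
          ENNReal.ofReal (√S.n ^ ((S.n : ℝ) + 2 * S.s) * h ^ (2 * S.s)) *
            gagliardoDensity S.s u x := by
      filter_upwards [Lp.coeFn_sub (S.cubeMean h A (S.embedTwo u)) (S.embedTwo u),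
        cubeMean_ae u hh A, coeFn_embed S.two_le_critExp u,
        ae_restrict_mem S.isOpen_Ω.measurableSet] with x h1 h2 h3 hx
      have hxQ : x ∈ gridCube h (fun i => ⌊x i / h⌋) := (mem_gridCube_iff hh).2 rfl
      rw [h1, Pi.sub_apply, h2 _ (hmem x hx) hxQ, embedTwo, h3, ← enorm_neg, neg_sub]
      exact enorm_sub_mean_gridCube_sq_le S.s_pos u.measurable u.memLp hh hxQ
    have hnorm : ‖S.cubeMean h A (S.embedTwo u) - S.embedTwo u‖ₑ ^ 2 ≤
        ENNReal.ofReal ((√(M * h ^ (2 * S.s)) * ‖u‖) ^ 2) := by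
      rw [Lp.enorm_def, eLpNorm_two_sq]
      refine (lintegral_mono_ae hpt).trans ?_
      rw [lintegral_const_mul' _ _ ENNReal.ofReal_ne_top]
      calc _ ≤ ENNReal.ofReal (√S.n ^ ((S.n : ℝ) + 2 * S.s) * h ^ (2 * S.s)) *
            (C * ENNReal.ofReal ‖u‖ ^ 2) := by
            gcongr
            exact (setLIntegral_le_lintegral _ _).trans (hC u)
        _ = _ := by
            rw [mul_pow, Real.sq_sqrt (by positivity), ← ENNReal.ofReal_pow (norm_nonneg _),
              ← ENNReal.ofReal_coe_nnreal, ← ENNReal.ofReal_mul C.coe_nonneg,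
              ← ENNReal.ofReal_mul (by positivity)]
            congr 1
            rw [hM]
            ring
    rw [sub_apply, ContinuousLinearMap.comp_apply]
    rw [← ofReal_norm, ← ENNReal.ofReal_pow (norm_nonneg _),
      ENNReal.ofReal_le_ofReal_iff (by positivity)] at hnorm
    exact (pow_le_pow_iff_left₀ (norm_nonneg _) (by positivity) two_ne_zero).1 hnorm
  choose A hA using fun j : ℕ => hfin (1 / ((j : ℝ) + 1)) (by positivity)
  refine isCompactOperator_of_tendsto (l := atTop)
    (F := fun j : ℕ => S.cubeMean (1 / ((j : ℝ) + 1)) (A j) ∘L S.embedTwo) ?_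
    (Eventually.of_forall fun j => (isCompactOperator_cubeMean _ _).comp_clm S.embedTwo)
  rw [tendsto_iff_norm_sub_tendsto_zero]
  refine squeeze_zero (fun _ => norm_nonneg _) hA ?_
  have h1 : Tendsto (fun t : ℝ => √(M * t ^ (2 * S.s))) (𝓝 0) (𝓝 √(M * 0 ^ (2 * S.s))) := by
    refine Continuous.tendsto ?_ 0
    exact Real.continuous_sqrt.comp
      (continuous_const.mul (Real.continuous_rpow_const (by linarith [S.s_pos])))
  rw [Real.zero_rpow (by linarith [S.s_pos]), mul_zero, Real.sqrt_zero] at h1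
  exact h1.comp tendsto_one_div_add_atTop_nhds_zero_nat

/-- Lyapunov's inequality between `L²(Ω)` and the critical space. -/
lemma exists_norm_embed_rpow_le (S : NonlocalSetting) {q : ℝ} (hq2 : 2 < q) (hq : q < S.critExp)
    [Fact (1 ≤ ENNReal.ofReal q)] (hq' : ENNReal.ofReal q ≤ ENNReal.ofReal S.critExp) :
    ∃ C a b : ℝ, 0 ≤ C ∧ 0 < a ∧ 0 < b ∧ ∀ u : S.X0,
      ‖S.embed (ENNReal.ofReal q) hq' u‖ ^ q ≤ C * ‖S.embedTwo u‖ ^ a * ‖u‖ ^ b := by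
  obtain ⟨C, hC⟩ := S.exists_eLpNorm_le (le_refl (ENNReal.ofReal S.critExp))
  set P := S.critExp with hP
  have hP2 : 2 < P := S.two_lt_critExp
  set t : ℝ := (P - q) / (P - 2) with ht
  set r : ℝ := (q - 2) / (P - 2) with hr
  have ht0 : 0 < t := div_pos (by linarith) (by linarith)
  have hr0 : 0 < r := div_pos (by linarith) (by linarith)
  have htr : t + r = 1 := by
    rw [ht, hr, ← add_div, div_eq_one_iff_eq (by linarith)]
    ring
  have hexp : 2 * t + P * r = q := by
    rw [ht, hr]
    have : P - 2 ≠ 0 := by linarith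
    field_simp
    ring
  refine ⟨C ^ (P * r), 2 * t, P * r, by positivity, by positivity, by positivity, fun u => ?_⟩
  set μ := volume.restrict S.Ω with hμ
  have hpow : ∀ p : ℝ, 0 < p → ∫⁻ x, ‖u x‖ₑ ^ p ∂μ = eLpNorm u (ENNReal.ofReal p) μ ^ p := by
    intro p hp
    rw [eLpNorm_eq_lintegral_rpow_enorm_toReal (by simpa using hp) ENNReal.ofReal_ne_top,
      ENNReal.toReal_ofReal hp.le, ← ENNReal.rpow_mul, one_div, inv_mul_cancel₀ hp.ne',
      ENNReal.rpow_one]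
  have hm : ∀ p : ℝ, AEMeasurable (fun x => ‖u x‖ₑ ^ p) μ := fun p =>
    (u.measurable.enorm.pow_const p).aemeasurable
  have h1 := ENNReal.lintegral_mul_norm_pow_le (hm 2) (hm P) ht0.le hr0.le htr
  have h2 : ∀ x, (‖u x‖ₑ ^ (2 : ℝ)) ^ t * (‖u x‖ₑ ^ P) ^ r = ‖u x‖ₑ ^ q := fun x => by
    rw [← ENNReal.rpow_mul, ← ENNReal.rpow_mul, ← ENNReal.rpow_add_of_nonneg _ _ (by positivity)
      (by positivity), hexp]
  simp only [h2] at h1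
  rw [hpow q (by linarith), hpow 2 two_pos, hpow P (by linarith), ← ENNReal.rpow_mul,
    ← ENNReal.rpow_mul, ENNReal.ofReal_ofNat] at h1
  have h3 := h1.trans (mul_le_mul_right (ENNReal.rpow_le_rpow (hC u)
    (by positivity : 0 ≤ P * r)) _)
  have h4 := ENNReal.toReal_mono (ENNReal.mul_ne_top
    (ENNReal.rpow_ne_top_of_nonneg (by positivity) (u.memLp_of_le S.two_le_critExp).2.ne)
    (ENNReal.rpow_ne_top_of_nonneg (by positivity)
      (ENNReal.mul_ne_top ENNReal.coe_ne_top ENNReal.ofReal_ne_top))) h3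
  rw [ENNReal.toReal_mul, ← ENNReal.toReal_rpow, ← ENNReal.toReal_rpow, ← ENNReal.toReal_rpow,
    ← norm_embed hq', ← norm_embed S.two_le_critExp, ENNReal.toReal_mul,
    ENNReal.toReal_ofReal (norm_nonneg _), ENNReal.coe_toReal,
    Real.mul_rpow C.coe_nonneg (norm_nonneg _)] at h4
  refine h4.trans (le_of_eq ?_)
  rw [embedTwo]
  ring

/-- Bounded sequences in `X₀` have a subsequence that converges in `L²(Ω)` and in `L^q(Ω)`. -/
lemma exists_subseq_tendsto_embed (S : NonlocalSetting) {q : ℝ} (hq2 : 2 < q) (hq : q < S.critExp)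
    [Fact (1 ≤ ENNReal.ofReal q)] (hq' : ENNReal.ofReal q ≤ ENNReal.ofReal S.critExp)
    (u : ℕ → S.X0) (R : ℝ) (hR : ∀ j, ‖u j‖ ≤ R) :
    ∃ φ : ℕ → ℕ, StrictMono φ ∧ ∃ v w, Tendsto (fun j => S.embedTwo (u (φ j))) atTop (𝓝 v) ∧
      Tendsto (fun j => S.embed (ENNReal.ofReal q) hq' (u (φ j))) atTop (𝓝 w) := by
  have hc : IsCompactOperator
      (S.embedTwo : S.X0 →ₗ[ℝ] Lp ℝ 2 (volume.restrict S.Ω)) := S.isCompactOperator_embedTwo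
  obtain ⟨K, hK, hKs⟩ := hc.image_closedBall_subset_compact R
  obtain ⟨v, -, φ, hφ, hv⟩ := hK.tendsto_subseq (x := fun j => S.embedTwo (u j)) fun j =>
    hKs ⟨u j, by simpa using hR j, rfl⟩
  obtain ⟨C, a, b, hC, ha, hb, H⟩ := S.exists_norm_embed_rpow_le hq2 hq hq'
  have hR0 : 0 ≤ R := (norm_nonneg _).trans (hR 0)
  have hcau : CauchySeq fun j => S.embed (ENNReal.ofReal q) hq' (u (φ j)) := by
    have h1 : Tendsto (fun p : ℕ × ℕ => ‖S.embedTwo (u (φ p.1)) - S.embedTwo (u (φ p.2))‖)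
        atTop (𝓝 0) := by
      have := cauchySeq_iff_tendsto_dist_atTop_0.1 hv.cauchySeq
      simpa only [dist_eq_norm, Function.comp] using this
    have h2 : Tendsto (fun x : ℝ => (C * x ^ a * (2 * R) ^ b) ^ (1 / q)) (𝓝 0) (𝓝 0) := by
      have h3 : Continuous fun x : ℝ => (C * x ^ a * (2 * R) ^ b) ^ (1 / q) :=
        (((continuous_const.mul (Real.continuous_rpow_const ha.le)).mul continuous_const)).rpow_const
          fun _ => Or.inr (by positivity)
      have h4 := h3.tendsto 0
      rwa [Real.zero_rpow ha.ne', mul_zero, zero_mul,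
        Real.zero_rpow (one_div_pos.2 (by linarith)).ne'] at h4
    refine cauchySeq_iff_tendsto_dist_atTop_0.2
      (squeeze_zero (fun _ => dist_nonneg) (fun p => ?_) (h2.comp h1))
    have h3 := H (u (φ p.1) - u (φ p.2))
    have h4 : ‖u (φ p.1) - u (φ p.2)‖ ≤ 2 * R := by
      refine (norm_sub_le _ _).trans ?_
      linarith [hR (φ p.1), hR (φ p.2)]
    rw [dist_eq_norm, ← map_sub]
    simp only [Function.comp]
    rw [← map_sub]
    rw [one_div]
    refine (Real.le_rpow_inv_iff_of_pos (norm_nonneg _) (by positivity) (by linarith)).2 ?_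
    exact h3.trans (by gcongr)
  obtain ⟨w, hw⟩ := cauchySeq_tendsto_of_complete hcau
  exact ⟨φ, hφ, v, w, hv, hw⟩

/-! ### The solution operator and the variational characterization of the eigenvalues -/

variable (S) in
/-- The operator `T` of `X₀` with `⟨T u, v⟩ = ∫_Ω u v`; its eigenvalues are the reciprocals of the
weak eigenvalues. -/
noncomputable def solOp : S.X0 →L[ℝ] S.X0 := ContinuousLinearMap.adjoint S.embedTwo ∘L S.embedTwo

lemma inner_solOp (u v : S.X0) : inner ℝ (S.solOp u) v = ∫ x in S.Ω, u x * v x := by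
  rw [solOp, ContinuousLinearMap.comp_apply, ContinuousLinearMap.adjoint_inner_left,
    inner_embedTwo]

lemma inner_solOp_comm (u v : S.X0) : inner ℝ (S.solOp u) v = inner ℝ u (S.solOp v) := by
  rw [inner_solOp, real_inner_comm, inner_solOp]
  simp only [mul_comm]

lemma inner_solOp_self_nonneg (u : S.X0) : 0 ≤ inner ℝ (S.solOp u) u := by
  rw [inner_solOp]
  exact integral_nonneg fun x => mul_self_nonneg _

lemma isSymmetric_solOp : (S.solOp : S.X0 →ₗ[ℝ] S.X0).IsSymmetric := inner_solOp_comm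

lemma isCompactOperator_solOp : IsCompactOperator S.solOp :=
  S.isCompactOperator_embedTwo.clm_comp (ContinuousLinearMap.adjoint S.embedTwo)

lemma isWeakEigen_iff {μ : ℝ} {u : S.X0} : IsWeakEigen μ u ↔ u = μ • S.solOp u := by
  have h : ∀ φ : S.X0, inner ℝ (μ • S.solOp u) φ = μ * ∫ x in S.Ω, u x * φ x := fun φ => by
    rw [real_inner_smul_left, inner_solOp]
  constructor
  · intro hu
    refine ext_inner_right ℝ fun φ => ?_
    rw [h]
    exact hu φ
  · intro hu φ
    rw [← h, ← hu]
    rfl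

namespace IsEigenSequence

variable {lam : ℕ → ℝ} {e : ℕ → S.X0} (he : IsEigenSequence lam e)
include he

lemma inner_solOp_eq {i j : ℕ} (hi : 1 ≤ i) (hj : 1 ≤ j) :
    inner ℝ (S.solOp (e i)) (e j) = if i = j then 1 else 0 := by
  rw [inner_solOp, he.orthonormal i j hi hj]

lemma inner_eq {i : ℕ} (hi : 1 ≤ i) (u : S.X0) :
    inner ℝ (e i) u = lam i * inner ℝ (S.solOp (e i)) u := by
  rw [← real_inner_smul_left, ← isWeakEigen_iff.1 (he.eigen i hi)]

lemma lam_pos {i : ℕ} (hi : 1 ≤ i) : 0 < lam i := by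
  have h1 := he.inner_eq hi (e i)
  rw [he.inner_solOp_eq hi hi, if_pos rfl, mul_one, real_inner_self_eq_norm_sq] at h1
  rw [← h1]
  have h2 : e i ≠ 0 := by
    intro h
    have := he.inner_solOp_eq hi hi
    rw [h, inner_zero_right, if_pos rfl] at this
    exact zero_ne_one this
  have := norm_pos_iff.2 h2
  positivity

lemma solOp_mem_PSpace {N : ℕ} {w : S.X0} (hw : w ∈ PSpace e N) : S.solOp w ∈ PSpace e N := by
  intro j h1 h2
  have h3 := he.inner_eq h1 w
  rw [real_inner_comm, hw j h1 h2, inner_solOp_comm] at h3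
  rw [real_inner_comm]
  exact (mul_eq_zero.1 h3.symm).resolve_left (he.lam_pos h1).ne'

/-- An eigenfunction in `ℙ_N` belongs to an eigenvalue that is at least `λ_{N+1}`. -/
lemma le_of_isWeakEigen {N : ℕ} {μ : ℝ} {u : S.X0} (hu : u ∈ PSpace e N) (hu0 : u ≠ 0)
    (hμ : IsWeakEigen μ u) : lam (N + 1) ≤ μ := by
  by_contra! hlt
  have h1 : Submodule.span ℝ {v | ∃ j, 1 ≤ j ∧ lam j = μ ∧ v = e j} ≤ (ℝ ∙ u)ᗮ := by
    rw [Submodule.span_le]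
    rintro v ⟨j, hj, hjμ, rfl⟩
    rw [SetLike.mem_coe, Submodule.mem_orthogonal_singleton_iff_inner_right]
    refine hu j hj ?_
    by_contra! hjN
    have := he.mono (N + 1) j (by omega) hjN
    linarith
  have h2 := Submodule.mem_orthogonal_singleton_iff_inner_right.1 (h1 (he.exhaustive μ u hμ))
  exact hu0 (inner_self_eq_zero.1 h2)

/-- The Poincaré inequality in `ℙ_N` with the constant `λ_{N+1}`: the norm of the restriction of the
compact self-adjoint operator `T` to `ℙ_N` is attained at an eigenvalue. -/
lemma mul_inner_solOp_le {N : ℕ} {w : S.X0} (hw : w ∈ PSpace e N) :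
    lam (N + 1) * inner ℝ (S.solOp w) w ≤ ‖w‖ ^ 2 := by
  have hcl : CompleteSpace (PSpace e N) := (isClosed_PSpace e N).completeSpace_coe
  have hinv : ∀ v ∈ PSpace e N, S.solOp v ∈ PSpace e N := fun v hv => he.solOp_mem_PSpace hv
  set A : PSpace e N →L[ℝ] PSpace e N := S.solOp.restrict hinv with hA
  have hAc : IsCompactOperator A := isCompactOperator_solOp.restrict' hinv
  have hAs : (A : PSpace e N →ₗ[ℝ] PSpace e N).IsSymmetric :=
    isSymmetric_solOp.restrict_invariant hinv
  have hpos : 0 < lam (N + 1) := he.lam_pos (by omega)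
  have hspec : ∀ μ ∈ spectrum ℝ A, |μ| ≤ (lam (N + 1))⁻¹ := by
    intro μ hμ
    by_cases hμ0 : μ = 0
    · rw [hμ0, abs_zero]
      positivity
    have h1 := (hAc.hasEigenvalue_iff_mem_spectrum hμ0).2 hμ
    obtain ⟨v, hv⟩ := h1.exists_hasEigenvector
    have hv1 : S.solOp v = μ • (v : S.X0) := congrArg Subtype.val hv.apply_eq_smul
    have hv0 : (v : S.X0) ≠ 0 := fun h => hv.2 (Subtype.ext h)
    have h2 : IsWeakEigen μ⁻¹ (v : S.X0) := by
      rw [isWeakEigen_iff, hv1, smul_smul, inv_mul_cancel₀ hμ0, one_smul]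
    have h3 := he.le_of_isWeakEigen v.2 hv0 h2
    have h4 : 0 < μ := inv_pos.1 (hpos.trans_le h3)
    rw [abs_of_pos h4]
    exact (le_inv_comm₀ hpos h4).1 h3
  have hnorm : ‖A‖ ≤ (lam (N + 1))⁻¹ := by
    have h1 := A.spectralRadius_eq_nnnorm hAs.isSelfAdjoint
    have h2 : spectralRadius ℝ A ≤ ENNReal.ofReal (lam (N + 1))⁻¹ := by
      refine iSup₂_le fun μ hμ => ?_
      rw [← enorm_eq_nnnorm, Real.enorm_eq_ofReal_abs]
      exact ENNReal.ofReal_le_ofReal (hspec μ hμ)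
    rw [h1, ← enorm_eq_nnnorm, ← ofReal_norm, ENNReal.ofReal_le_ofReal_iff (by positivity)] at h2
    exact h2
  have h1 : inner ℝ (S.solOp w) w ≤ (lam (N + 1))⁻¹ * ‖w‖ ^ 2 := by
    refine (real_inner_le_norm _ _).trans ?_
    have h2 := A.le_of_opNorm_le hnorm ⟨w, hw⟩
    have h3 : ‖S.solOp w‖ ≤ (lam (N + 1))⁻¹ * ‖w‖ := h2
    nlinarith [norm_nonneg w]
  calc lam (N + 1) * inner ℝ (S.solOp w) w ≤ lam (N + 1) * ((lam (N + 1))⁻¹ * ‖w‖ ^ 2) := by gcongr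
    _ = ‖w‖ ^ 2 := by rw [← mul_assoc, mul_inv_cancel₀ hpos.ne', one_mul]

lemma norm_sq_le_of_mem_HSpace {N : ℕ} {v : S.X0} (hv : v ∈ HSpace e N) :
    ‖v‖ ^ 2 ≤ lam N * inner ℝ (S.solOp v) v := by
  classical
  rw [HSpace, ← Finset.coe_Icc, Submodule.mem_span_image_finset_iff_exists_fun] at hv
  obtain ⟨c', hc'⟩ := hv
  obtain ⟨c, rfl⟩ : ∃ c : ℕ → ℝ, ∑ i ∈ Finset.Icc 1 N, c i • e i = v := by
    refine ⟨fun i => if h : i ∈ Finset.Icc 1 N then c' ⟨i, h⟩ else 0, ?_⟩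
    rw [← hc', ← Finset.sum_coe_sort]
    exact Finset.sum_congr rfl fun i _ => by beta_reduce; rw [dif_pos i.2]
  clear hc'
  set v := ∑ i ∈ Finset.Icc 1 N, c i • e i with hv
  have h1 : ∀ i ∈ Finset.Icc 1 N, inner ℝ (S.solOp (e i)) v = c i := by
    intro i hi
    rw [hv, inner_sum, Finset.sum_eq_single_of_mem i hi]
    · rw [real_inner_smul_right, he.inner_solOp_eq (Finset.mem_Icc.1 hi).1 (Finset.mem_Icc.1 hi).1,
        if_pos rfl, mul_one]
    · intro j hj hne
      rw [real_inner_smul_right, he.inner_solOp_eq (Finset.mem_Icc.1 hi).1 (Finset.mem_Icc.1 hj).1,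
        if_neg hne.symm, mul_zero]
  have h2 : inner ℝ (S.solOp v) v = ∑ i ∈ Finset.Icc 1 N, c i * c i := by
    conv_lhs => rw [hv, map_sum, sum_inner, ← hv]
    refine Finset.sum_congr rfl fun i hi => ?_
    rw [map_smul, real_inner_smul_left, h1 i hi]
  have h3 : ‖v‖ ^ 2 = ∑ i ∈ Finset.Icc 1 N, lam i * (c i * c i) := by
    rw [← real_inner_self_eq_norm_sq]
    conv_lhs => rw [hv, sum_inner, ← hv]
    refine Finset.sum_congr rfl fun i hi => ?_
    rw [real_inner_smul_left, he.inner_eq (Finset.mem_Icc.1 hi).1, h1 i hi]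
    ring
  rw [h2, h3, Finset.mul_sum]
  refine Finset.sum_le_sum fun i hi => ?_
  rw [Finset.mem_Icc] at hi
  exact mul_le_mul_of_nonneg_right (he.mono i N hi.1 hi.2) (mul_self_nonneg _)

end IsEigenSequence

lemma inner_eq_zero_of_mem {e : ℕ → S.X0} {M N : ℕ} (hMN : M ≤ N) {v w : S.X0}
    (hv : v ∈ HSpace e M) (hw : w ∈ PSpace e N) : inner ℝ v w = 0 := by
  have h1 : HSpace e M ≤ (ℝ ∙ w)ᗮ := by
    rw [HSpace, Submodule.span_le]
    rintro _ ⟨j, hj, rfl⟩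
    rw [SetLike.mem_coe, Submodule.mem_orthogonal_singleton_iff_inner_right]
    exact hw j hj.1 (hj.2.trans hMN)
  rw [real_inner_comm]
  exact Submodule.mem_orthogonal_singleton_iff_inner_right.1 (h1 hv)

/-! ### The gradient of the superposition functional -/

section

variable {p p' : ENNReal} [Fact (1 ≤ p)] [Fact (1 ≤ p')] [ENNReal.HolderConjugate p' p]
  (hc : p ≤ ENNReal.ofReal S.critExp)

variable (p') in
/-- The element of `X₀` that represents the functional `v ↦ ∫_Ω G v` for `G ∈ L^p'(Ω)`. -/
noncomputable def dualMap (G : Lp ℝ p' (volume.restrict S.Ω)) : S.X0 :=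
  (InnerProductSpace.toDual ℝ S.X0).symm
    (((ContinuousLinearMap.mul ℝ ℝ).lpPairing (volume.restrict S.Ω) p' p G).comp (S.embed p hc))

lemma inner_dualMap (G : Lp ℝ p' (volume.restrict S.Ω)) (v : S.X0) :
    inner ℝ (dualMap p' hc G) v = ∫ x in S.Ω, G x * v x := by
  rw [dualMap, InnerProductSpace.toDual_symm_apply, ContinuousLinearMap.comp_apply,
    ContinuousLinearMap.lpPairing_eq_integral]
  refine integral_congr_ae ?_
  filter_upwards [coeFn_embed hc v] with x hx
  rw [hx]
  rfl

lemma continuous_dualMap :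
    Continuous (dualMap p' hc : Lp ℝ p' (volume.restrict S.Ω) → S.X0) := by
  refine (InnerProductSpace.toDual ℝ S.X0).symm.continuous.comp ?_
  exact ((ContinuousLinearMap.mul ℝ ℝ).lpPairing (volume.restrict S.Ω) p' p).continuous.clm_comp
    continuous_const

lemma exists_norm_dualMap_le : ∃ M : ℝ, 0 ≤ M ∧ ∀ G : Lp ℝ p' (volume.restrict S.Ω),
    ‖dualMap p' hc G‖ ≤ M * ‖G‖ := by
  set B := (ContinuousLinearMap.mul ℝ ℝ).lpPairing (volume.restrict S.Ω) p' p with hB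
  refine ⟨‖B‖ * ‖S.embed p hc‖, by positivity, fun G => ?_⟩
  rw [dualMap, LinearIsometryEquiv.norm_map]
  refine (ContinuousLinearMap.opNorm_comp_le _ _).trans ?_
  rw [mul_right_comm]
  gcongr
  exact B.le_opNorm G

lemma hasGradientAt_integral_primitive {κ : ℝ} {g : S.E → ℝ → ℝ}
    (hg : IsNemytskii (volume.restrict S.Ω) p' κ g) (hκ : 0 < κ) (hp : p = p' * ENNReal.ofReal κ)
    (hp' : p' ≠ ⊤) (u : S.X0) :
    HasGradientAt (fun u : S.X0 => ∫ x in S.Ω, (∫ τ in (0 : ℝ)..(u x), g x τ))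
      (dualMap p' hc (hg.op hκ hp (S.embed p hc u))) u := by
  have h1 := (hg.hasFDerivAt hκ hp hp' (S.embed p hc u)).comp u (S.embed p hc).hasFDerivAt
  have h2 : ((fun w : Lp ℝ p (volume.restrict S.Ω) =>
      ∫ x in S.Ω, (∫ τ in (0 : ℝ)..(w x), g x τ)) ∘ S.embed p hc) =
      fun u : S.X0 => ∫ x in S.Ω, (∫ τ in (0 : ℝ)..(u x), g x τ) := by
    funext v
    refine integral_congr_ae ?_
    filter_upwards [coeFn_embed hc v] with x hx
    rw [hx]
  rw [h2] at h1
  rw [HasGradientAt, HasGradientAtFilter, dualMap, LinearIsometryEquiv.apply_symm_apply]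
  exact h1

end

/-- The gradient of the quadratic part of the functional. -/
lemma hasGradientAt_quadratic (l : ℝ) (u : S.X0) :
    HasGradientAt (fun u : S.X0 => 1 / 2 * ‖u‖ ^ 2 - l / 2 * inner ℝ (S.solOp u) u)
      (u - l • S.solOp u) u := by
  rw [hasGradientAt_iff_hasFDerivAt]
  have h1 := (hasStrictFDerivAt_norm_sq u).hasFDerivAt.const_mul (1 / 2 : ℝ)
  have h2 := ((S.solOp.hasFDerivAt (x := u)).inner ℝ (hasFDerivAt_id u)).const_mul (l / 2)
  refine (h1.sub h2).congr_fderiv ?_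
  ext v
  have h3 : inner ℝ (S.solOp v) u = inner ℝ (S.solOp u) v := by
    rw [inner_solOp_comm, real_inner_comm]
  simp only [fderivInnerCLM_apply, id_eq, sub_apply, smul_apply, coe_innerSL_apply, smul_eq_mul,
    ContinuousLinearMap.comp_apply, ContinuousLinearMap.prod_apply, ContinuousLinearMap.id_apply,
    map_sub, map_smul, InnerProductSpace.toDual_apply_apply, nsmul_eq_mul, h3]
  push_cast
  ring

lemma J_eq (f : S.E → ℝ → ℝ) (l : ℝ) (u : S.X0) :
    S.J f l u = 1 / 2 * ‖u‖ ^ 2 - l / 2 * inner ℝ (S.solOp u) u -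
      ∫ x in S.Ω, S.primitive f x (u x) := by
  rw [J, inner_solOp, ← real_inner_self_eq_norm_sq, X0.inner_def]
  simp only [sq_abs]
  simp only [sq]

namespace IsNonlinearity

variable {f : S.E → ℝ → ℝ} {q : ℝ} (hf : S.IsNonlinearity f q)
include hf

lemma holderConjugate : q.conjExponent.HolderConjugate q :=
  (Real.HolderConjugate.conjExponent (by linarith [hf.two_lt])).symm

lemma conjExponent_mul : (q - 1) * q.conjExponent = q :=
  hf.holderConjugate.symm.sub_one_mul_conj

lemma conjExponent_lt_two : q.conjExponent < 2 := by
  have := hf.two_lt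
  rw [Real.conjExponent, div_lt_iff₀ (by linarith)]
  linarith

lemma one_lt_conjExponent : 1 < q.conjExponent := hf.holderConjugate.lt

lemma ofReal_eq : ENNReal.ofReal q =
    ENNReal.ofReal q.conjExponent * ENNReal.ofReal (q - 1) := by
  rw [← ENNReal.ofReal_mul (by linarith [hf.one_lt_conjExponent]), mul_comm, hf.conjExponent_mul]

/-- The nonlinearity agrees almost everywhere with a jointly measurable one. -/
lemma exists_isNemytskii : ∃ g : S.E → ℝ → ℝ, (∀ᵐ x ∂(volume.restrict S.Ω), g x = f x) ∧
    IsNemytskii (volume.restrict S.Ω) (ENNReal.ofReal q.conjExponent) (q - 1) g := by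
  obtain ⟨a₁, a₂, h₁, h₂, hgr⟩ := hf.growth
  obtain ⟨g, hgf, hgm, hgc, hg⟩ := exists_measurable_uncurry_ae_eq hf.measurable hf.continuous
    (P := fun φ => ∀ t, |φ t| ≤ a₁ + a₂ * |t| ^ (q - 1)) hgr
  refine ⟨g, hgf, hgm, hgc, fun _ => a₁, a₂, memLp_const a₁, h₂.le, fun x t => ?_⟩
  rcases hg x with h | h
  · exact h t
  · rw [h, Pi.zero_apply, abs_zero]
    positivity

/-- The nonlinearity is superlinear at zero. -/
lemma exists_abs_le {ε : ℝ} (hε : 0 < ε) : ∃ C : ℝ, 0 ≤ C ∧ ∀ᵐ x ∂(volume.restrict S.Ω),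
    ∀ t, |f x t| ≤ ε * |t| + C * |t| ^ (q - 1) := by
  obtain ⟨a₁, a₂, h₁, h₂, hgr⟩ := hf.growth
  have hq := hf.two_lt
  have h1 := Metric.tendstoUniformlyOn_iff.1 hf.limit_zero ε hε
  rw [eventually_nhdsWithin_iff, Metric.eventually_nhds_iff] at h1
  obtain ⟨δ, hδ, h1⟩ := h1
  refine ⟨a₁ / δ ^ (q - 1) + a₂, by positivity, ?_⟩
  filter_upwards [hgr, hf.continuous, ae_restrict_mem S.isOpen_Ω.measurableSet] with x hx hcx hxΩ t
  have hC : 0 ≤ (a₁ / δ ^ (q - 1) + a₂) * |t| ^ (q - 1) := by positivity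
  by_cases ht0 : t = 0
  · -- `f(x, 0) = 0` by continuity
    have h2 : Tendsto (fun t => f x t / |t| * |t|) (𝓝[≠] 0) (𝓝 (0 * |0|)) :=
      (hf.limit_zero.tendsto_at hxΩ).mul (continuous_abs.continuousAt.mono_left nhdsWithin_le_nhds)
    have h3 : Tendsto (fun t => f x t / |t| * |t|) (𝓝[≠] 0) (𝓝 (f x 0)) := by
      refine ((hcx.tendsto 0).mono_left nhdsWithin_le_nhds).congr' ?_
      filter_upwards [self_mem_nhdsWithin] with t ht
      exact (div_mul_cancel₀ _ (abs_ne_zero.2 ht)).symm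
    have h4 := tendsto_nhds_unique h3 h2
    rw [ht0, h4]
    simp only [abs_zero, mul_zero, zero_add]
    positivity
  · have htp : 0 < |t| := abs_pos.2 ht0
    by_cases htδ : |t| < δ
    · have h2 := h1 (y := t) (by simpa using htδ) ht0 x hxΩ
      rw [dist_zero_left, Real.norm_eq_abs, abs_div, abs_abs, div_lt_iff₀ htp] at h2
      linarith
    · push Not at htδ
      have h2 : a₁ ≤ a₁ / δ ^ (q - 1) * |t| ^ (q - 1) := by
        rw [div_mul_eq_mul_div, le_div_iff₀ (by positivity)]
        gcongr
        linarith
      have h3 := hx t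
      have h4 : 0 ≤ ε * |t| := by positivity
      rw [add_mul]
      linarith

lemma ofReal_le_critExp : ENNReal.ofReal q ≤ ENNReal.ofReal S.critExp :=
  ENNReal.ofReal_le_ofReal hf.lt_critical.le

end IsNonlinearity

/-! ### The properties of the superposition functional and its gradient -/

lemma integral_primitive_congr {f g : S.E → ℝ → ℝ} (hgf : ∀ᵐ x ∂(volume.restrict S.Ω), g x = f x)
    (u : S.X0) : ∫ x in S.Ω, S.primitive f x (u x) =
      ∫ x in S.Ω, (∫ τ in (0 : ℝ)..(u x), g x τ) := by
  refine integral_congr_ae ?_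
  filter_upwards [hgf] with x hx
  rw [hx, primitive]

namespace IsNonlinearity

variable {f : S.E → ℝ → ℝ} {q : ℝ} (hf : S.IsNonlinearity f q)
include hf

lemma primitive_nonneg : ∀ᵐ x ∂(volume.restrict S.Ω), ∀ t, 0 ≤ S.primitive f x t := by
  filter_upwards [hf.superquadratic] with x hx t
  by_cases ht : t = 0
  · rw [ht, primitive, intervalIntegral.integral_same]
  · exact (pos_of_mul_pos_right (hx t ht).1 (by linarith [hf.two_lt])).le

lemma superquadratic_all : ∀ᵐ x ∂(volume.restrict S.Ω), ∀ t,
    q * S.primitive f x t ≤ f x t * t := by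
  filter_upwards [hf.superquadratic] with x hx t
  by_cases ht : t = 0
  · rw [ht, primitive, intervalIntegral.integral_same, mul_zero, mul_zero]
  · rw [mul_comm (f x t)]
    exact (hx t ht).2

lemma integral_primitive_nonneg (u : S.X0) : 0 ≤ ∫ x in S.Ω, S.primitive f x (u x) := by
  refine integral_nonneg_of_ae ?_
  filter_upwards [hf.primitive_nonneg] with x hx
  exact hx _

section

variable [Fact (1 ≤ ENNReal.ofReal q)] [Fact (1 ≤ ENNReal.ofReal q.conjExponent)]
  [ENNReal.HolderConjugate (ENNReal.ofReal q.conjExponent) (ENNReal.ofReal q)]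
  {g : S.E → ℝ → ℝ} (hgf : ∀ᵐ x ∂(volume.restrict S.Ω), g x = f x)
  (hg : IsNemytskii (volume.restrict S.Ω) (ENNReal.ofReal q.conjExponent) (q - 1) g)

/-- The gradient of `u ↦ ∫_Ω F(x, u)`, expressed through the jointly measurable version `g`
of the nonlinearity. -/
noncomputable def superGrad (u : S.X0) : S.X0 :=
  dualMap (ENNReal.ofReal q.conjExponent) hf.ofReal_le_critExp
    (hg.op (by linarith [hf.two_lt]) hf.ofReal_eq
      (S.embed (ENNReal.ofReal q) hf.ofReal_le_critExp u))

lemma continuous_superGrad : Continuous (hf.superGrad hg) :=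
  (continuous_dualMap hf.ofReal_le_critExp).comp
    ((hg.continuous_op (by linarith [hf.two_lt]) hf.ofReal_eq ENNReal.ofReal_ne_top).comp
      (S.embed (ENNReal.ofReal q) hf.ofReal_le_critExp).continuous)

include hgf hg

omit [Fact (1 ≤ ENNReal.ofReal q)] [Fact (1 ≤ ENNReal.ofReal q.conjExponent)] in
lemma integrable_primitive (u : S.X0) :
    Integrable (fun x => S.primitive f x (u x)) (volume.restrict S.Ω) := by
  refine (hg.integrable_primitive (by linarith [hf.two_lt]) hf.ofReal_eq
    (u.memLp_of_le hf.ofReal_le_critExp)).congr ?_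
  filter_upwards [hgf] with x hx
  rw [hx, primitive]

lemma hasGradientAt_J (l : ℝ) (u : S.X0) :
    HasGradientAt (S.J f l) (u - l • S.solOp u - hf.superGrad hg u) u := by
  have h1 := (hasGradientAt_quadratic l u).hasFDerivAt.sub
    (hasGradientAt_integral_primitive hf.ofReal_le_critExp hg (by linarith [hf.two_lt])
      hf.ofReal_eq ENNReal.ofReal_ne_top u).hasFDerivAt
  rw [hasGradientAt_iff_hasFDerivAt, map_sub]
  refine h1.congr_of_eventuallyEq (Eventually.of_forall fun v => ?_)
  rw [J_eq, integral_primitive_congr hgf]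
  rfl

lemma superquadratic_le (u : S.X0) :
    q * ∫ x in S.Ω, S.primitive f x (u x) ≤ inner ℝ (hf.superGrad hg u) u := by
  have hκ : 0 < q - 1 := by linarith [hf.two_lt]
  rw [superGrad, inner_dualMap, ← integral_const_mul]
  have h1 := (Lp.memLp (hg.op hκ hf.ofReal_eq
    (S.embed (ENNReal.ofReal q) hf.ofReal_le_critExp u))).integrable_mul
    (u.memLp_of_le hf.ofReal_le_critExp)
  refine integral_mono_ae ((hf.integrable_primitive hgf hg u).const_mul q) h1 ?_
  filter_upwards [hg.coeFn_op hκ hf.ofReal_eq (S.embed (ENNReal.ofReal q) hf.ofReal_le_critExp u),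
    coeFn_embed hf.ofReal_le_critExp u, hgf, hf.superquadratic_all] with x h1 h2 h3 h4
  rw [h1, h2, h3]
  exact h4 _

omit [Fact (1 ≤ ENNReal.ofReal q)] [Fact (1 ≤ ENNReal.ofReal q.conjExponent)] in
lemma integral_primitive_pos {u : S.X0} (hu : u ≠ 0) :
    0 < ∫ x in S.Ω, S.primitive f x (u x) := by
  refine lt_of_le_of_ne (hf.integral_primitive_nonneg u) fun h => hu ?_
  have h1 : (fun x => S.primitive f x (u x)) =ᵐ[volume.restrict S.Ω] 0 := by
    refine (integral_eq_zero_iff_of_nonneg_ae ?_ (hf.integrable_primitive hgf hg u)).1 h.symm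
    filter_upwards [hf.primitive_nonneg] with x hx
    exact hx _
  refine X0.eq_zero_of_ae ?_
  filter_upwards [h1, hf.superquadratic] with x h2 h3
  by_contra hne
  have h4 := (h3 _ hne).1
  rw [h2, Pi.zero_apply, mul_zero] at h4
  exact lt_irrefl _ h4

/-- The gradient is controlled by a power of the functional. -/
lemma exists_norm_superGrad_rpow_le : ∃ D : ℝ, ∀ u : S.X0,
    ‖hf.superGrad hg u‖ ^ q.conjExponent ≤ D * (1 + ∫ x in S.Ω, S.primitive f x (u x)) := by
  have hκ : 0 < q - 1 := by linarith [hf.two_lt]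
  have hq0 : 0 < q := by linarith [hf.two_lt]
  have hr0 : 0 ≤ q.conjExponent := by linarith [hf.one_lt_conjExponent]
  obtain ⟨M, hM, hdual⟩ := exists_norm_dualMap_le (p' := ENNReal.ofReal q.conjExponent) hf.ofReal_le_critExp
  obtain ⟨A, b, hA, hb, hgr⟩ := hg.growth
  obtain ⟨a₃, a₄, h₃, h₄, hlow⟩ := hf.primitive_lower
  set a : ℝ := (eLpNorm A (ENNReal.ofReal q.conjExponent) (volume.restrict S.Ω)).toReal with ha
  have ha0 : 0 ≤ a := ENNReal.toReal_nonneg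
  set V : ℝ := (volume.restrict S.Ω).real Set.univ with hV
  have hV0 : 0 ≤ V := measureReal_nonneg
  refine ⟨M ^ q.conjExponent * (2 ^ q.conjExponent * a ^ q.conjExponent + 2 ^ q.conjExponent * (b ^ q.conjExponent * ((1 + a₄ * V) / a₃))), fun u => ?_⟩
  set Φ := ∫ x in S.Ω, S.primitive f x (u x) with hΦ
  have hΦ0 : 0 ≤ Φ := hf.integral_primitive_nonneg u
  set w := S.embed (ENNReal.ofReal q) hf.ofReal_le_critExp u with hw
  have hmem := u.memLp_of_le hf.ofReal_le_critExp
  have h1 : ‖hg.op hκ hf.ofReal_eq w‖ ≤ a + b * ‖w‖ ^ (q - 1) :=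
    hg.norm_op_le hκ hf.ofReal_eq w hA hb (Eventually.of_forall fun x =>
      (hgr x (w x)).trans (by gcongr; exact le_abs_self _))
  have h2 : ‖w‖ ^ q = ∫ x in S.Ω, |u x| ^ q := by
    rw [hw, norm_embed, hmem.eLpNorm_eq_integral_rpow_norm (by simpa using hq0)
      ENNReal.ofReal_ne_top, ENNReal.toReal_ofReal hq0.le,
      ENNReal.toReal_ofReal (by positivity), ← Real.rpow_mul (by positivity),
      inv_mul_cancel₀ hq0.ne', Real.rpow_one]
    rfl
  have hint : Integrable (fun x => |u x| ^ q) (volume.restrict S.Ω) := by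
    have := hmem.integrable_norm_rpow (by simpa using hq0) ENNReal.ofReal_ne_top
    rwa [ENNReal.toReal_ofReal hq0.le] at this
  have h3 : a₃ * ‖w‖ ^ q ≤ Φ + a₄ * V := by
    have h4 : ∫ x in S.Ω, (a₃ * |u x| ^ q - a₄) ≤ Φ := by
      refine integral_mono_ae ((hint.const_mul a₃).sub (integrable_const a₄))
        (hf.integrable_primitive hgf hg u) ?_
      filter_upwards [hlow] with x hx
      exact hx _
    rw [integral_sub (hint.const_mul a₃) (integrable_const a₄), integral_const_mul, ← h2,
      integral_const, smul_eq_mul, mul_comm _ a₄] at h4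
    linarith
  have h4 : ‖w‖ ^ q ≤ (1 + a₄ * V) / a₃ * (1 + Φ) := by
    rw [div_mul_eq_mul_div, le_div_iff₀ h₃]
    nlinarith [mul_nonneg (mul_nonneg h₄.le hV0) hΦ0]
  have h5 : (a + b * ‖w‖ ^ (q - 1)) ^ q.conjExponent ≤ 2 ^ q.conjExponent * a ^ q.conjExponent + 2 ^ q.conjExponent * (b ^ q.conjExponent * ‖w‖ ^ q) := by
    have h6 := abs_add_rpow_le hr0 a (b * ‖w‖ ^ (q - 1))
    have h7 : 0 ≤ b * ‖w‖ ^ (q - 1) := by positivity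
    rw [abs_of_nonneg (add_nonneg ha0 h7), abs_of_nonneg ha0, abs_of_nonneg h7,
      Real.mul_rpow hb (by positivity), ← Real.rpow_mul (norm_nonneg _),
      hf.conjExponent_mul] at h6
    exact h6
  calc ‖hf.superGrad hg u‖ ^ q.conjExponent ≤ (M * (a + b * ‖w‖ ^ (q - 1))) ^ q.conjExponent := by
        refine Real.rpow_le_rpow (norm_nonneg _) ((hdual _).trans ?_) hr0
        gcongr
    _ = M ^ q.conjExponent * (a + b * ‖w‖ ^ (q - 1)) ^ q.conjExponent := Real.mul_rpow hM (by positivity)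
    _ ≤ M ^ q.conjExponent * (2 ^ q.conjExponent * a ^ q.conjExponent + 2 ^ q.conjExponent * (b ^ q.conjExponent * ((1 + a₄ * V) / a₃ * (1 + Φ)))) := by
        gcongr
        exact h5.trans (by gcongr)
    _ ≤ M ^ q.conjExponent * (2 ^ q.conjExponent * a ^ q.conjExponent * (1 + Φ) + 2 ^ q.conjExponent * (b ^ q.conjExponent * ((1 + a₄ * V) / a₃ * (1 + Φ)))) := by
        refine mul_le_mul_of_nonneg_left (add_le_add ?_ le_rfl) (by positivity)
        exact le_mul_of_one_le_right (by positivity) (by linarith)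
    _ = _ := by ring

/-- The gradient is superlinear at the origin. -/
lemma exists_norm_superGrad_le {ε : ℝ} (hε : 0 < ε) : ∃ δ : ℝ, 0 < δ ∧ ∀ u : S.X0, ‖u‖ < δ →
    ‖hf.superGrad hg u‖ ≤ ε * ‖u‖ := by
  have hκ : 0 < q - 1 := by linarith [hf.two_lt]
  obtain ⟨M, hM, hdual⟩ := exists_norm_dualMap_le (p' := ENNReal.ofReal q.conjExponent) hf.ofReal_le_critExp
  have hrc : ENNReal.ofReal q.conjExponent ≤ ENNReal.ofReal S.critExp :=
    ENNReal.ofReal_le_ofReal (by linarith [hf.conjExponent_lt_two, S.two_lt_critExp])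
  set ι := S.embed (ENNReal.ofReal q) hf.ofReal_le_critExp with hι
  set κ := S.embed (ENNReal.ofReal q.conjExponent) hrc with hκ'
  set η : ℝ := ε / (2 * (M * ‖κ‖ + 1)) with hη
  have hη0 : 0 < η := by positivity
  obtain ⟨C, hC, hsm⟩ := hf.exists_abs_le hη0
  have hlim : Tendsto (fun t : ℝ => M * (C * (‖ι‖ ^ (q - 1) * t ^ (q - 2)))) (𝓝 0) (𝓝 0) := by
    have hq2 : 0 < q - 2 := by linarith [hf.two_lt]
    have h1 : Continuous fun t : ℝ => M * (C * (‖ι‖ ^ (q - 1) * t ^ (q - 2))) :=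
      continuous_const.mul (continuous_const.mul
        (continuous_const.mul (Real.continuous_rpow_const hq2.le)))
    have h2 := h1.tendsto 0
    rwa [Real.zero_rpow hq2.ne', mul_zero, mul_zero, mul_zero] at h2
  obtain ⟨δ, hδ, hball⟩ := Metric.eventually_nhds_iff.1 (hlim.eventually_le_const (half_pos hε))
  refine ⟨δ, hδ, fun u hu => ?_⟩
  have h1 : ‖hg.op hκ hf.ofReal_eq (ι u)‖ ≤ η * (‖κ‖ * ‖u‖) + C * ‖ι u‖ ^ (q - 1) := by
    have hmem := (u.memLp_of_le hrc).const_smul η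
    refine (hg.norm_op_le hκ hf.ofReal_eq (ι u) hmem hC ?_).trans ?_
    · filter_upwards [hsm, hgf, coeFn_embed hf.ofReal_le_critExp u] with x h1 h2 h3
      rw [h2, hι, h3, Pi.smul_apply, smul_eq_mul, abs_mul, abs_of_pos hη0]
      exact h1 _
    · gcongr
      rw [eLpNorm_const_smul, ENNReal.toReal_mul, toReal_enorm, Real.norm_of_nonneg hη0.le,
        ← norm_embed hrc]
      gcongr
      exact κ.le_opNorm u
  have h2 : ‖ι u‖ ^ (q - 1) ≤ ‖ι‖ ^ (q - 1) * (‖u‖ ^ (q - 2) * ‖u‖) := by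
    refine (Real.rpow_le_rpow (norm_nonneg _) (ι.le_opNorm u) hκ.le).trans (le_of_eq ?_)
    rw [Real.mul_rpow (norm_nonneg _) (norm_nonneg _)]
    congr 1
    rcases (norm_nonneg u).eq_or_lt with h | h
    · rw [← h, Real.zero_rpow hκ.ne', mul_zero]
    · rw [← Real.rpow_add_one h.ne']
      congr 1
      ring
  have h3 : M * (C * (‖ι‖ ^ (q - 1) * ‖u‖ ^ (q - 2))) ≤ ε / 2 :=
    hball (by simpa using hu)
  have h4 : M * (η * ‖κ‖) ≤ ε / 2 := by
    rw [hη]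
    have : M * (ε / (2 * (M * ‖κ‖ + 1)) * ‖κ‖) = ε / 2 * (M * ‖κ‖ / (M * ‖κ‖ + 1)) := by
      field_simp
    rw [this]
    refine mul_le_of_le_one_right (half_pos hε).le ?_
    rw [div_le_one (by positivity)]
    linarith
  calc ‖hf.superGrad hg u‖ ≤ M * ‖hg.op hκ hf.ofReal_eq (ι u)‖ := hdual _
    _ ≤ M * (η * (‖κ‖ * ‖u‖) + C * (‖ι‖ ^ (q - 1) * (‖u‖ ^ (q - 2) * ‖u‖))) := by
        gcongr
        exact h1.trans (by gcongr)
    _ = M * (η * ‖κ‖) * ‖u‖ + M * (C * (‖ι‖ ^ (q - 1) * ‖u‖ ^ (q - 2))) * ‖u‖ := by ring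
    _ ≤ ε / 2 * ‖u‖ + ε / 2 * ‖u‖ := by gcongr
    _ = ε * ‖u‖ := by ring

omit hgf in
lemma exists_subseq_tendsto (u : ℕ → S.X0) (R : ℝ) (hR : ∀ j, ‖u j‖ ≤ R) :
    ∃ φ : ℕ → ℕ, StrictMono φ ∧ ∃ a b : S.X0,
      Tendsto (fun j => S.solOp (u (φ j))) atTop (𝓝 a) ∧
      Tendsto (fun j => hf.superGrad hg (u (φ j))) atTop (𝓝 b) := by
  obtain ⟨φ, hφ, v, w, hv, hw⟩ := S.exists_subseq_tendsto_embed hf.two_lt hf.lt_critical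
    hf.ofReal_le_critExp u R hR
  refine ⟨φ, hφ, _, _, ((ContinuousLinearMap.adjoint S.embedTwo).continuous.tendsto v).comp hv,
    ((((continuous_dualMap hf.ofReal_le_critExp).comp (hg.continuous_op
      (by linarith [hf.two_lt]) hf.ofReal_eq ENNReal.ofReal_ne_top)).tendsto w).comp hw)⟩

end

end IsNonlinearity

end NonlocalSetting

/-! ### The `∇`-condition for the nonlocal functional -/

open NonlocalSetting in
theorem proposition5p3 (S : NonlocalSetting) (f : S.E → ℝ → ℝ) (q : ℝ)
    (hf : S.IsNonlinearity f q)
    (lam : ℕ → ℝ) (e : ℕ → S.X0) (he : NonlocalSetting.IsEigenSequence lam e)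
    (k m : ℕ) (hk : 2 ≤ k) (hm : 1 ≤ m)
    (hlt : lam (k - 1) < lam k)
    (heq : ∀ j, k ≤ j → j ≤ k + m - 1 → lam j = lam k)
    (hgt : lam (k + m - 1) < lam (k + m)) :
    ∀ σ : ℝ, 0 < σ → ∃ εσ : ℝ, 0 < εσ ∧
      ∀ l ∈ Set.Icc (lam (k - 1) + σ) (lam (k + m) - σ),
        ∀ ε' ε'' : ℝ, 0 < ε' → ε' < ε'' → ε'' < εσ →
          NablaCondition (S.J f l)
            (NonlocalSetting.HSpace e (k - 1) ⊔ NonlocalSetting.PSpace e (k + m - 1))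
            (ε' : EReal) (ε'' : EReal) := by
  intro σ hσ
  have : Fact (1 ≤ ENNReal.ofReal q) := ⟨by
    rw [ENNReal.one_le_ofReal]
    linarith [hf.two_lt]⟩
  have : Fact (1 ≤ ENNReal.ofReal q.conjExponent) := ⟨by
    rw [ENNReal.one_le_ofReal]
    exact hf.one_lt_conjExponent.le⟩
  have : ENNReal.HolderConjugate (ENNReal.ofReal q.conjExponent) (ENNReal.ofReal q) :=
    hf.holderConjugate.ennrealOfReal
  obtain ⟨g, hgf, hg⟩ := hf.exists_isNemytskii
  obtain ⟨D, hD⟩ := hf.exists_norm_superGrad_rpow_le hgf hg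
  have hk1 : 0 < lam (k - 1) := he.lam_pos (by omega)
  have hkm : 0 < lam (k + m) := he.lam_pos (by omega)
  have hsucc : k + m - 1 + 1 = k + m := by omega
  -- on `ℍ_{k-1}`, `l ∫ v² - ‖v‖² ≥ (l / λ_{k-1} - 1) ‖v‖²`, and on `ℙ_{k+m-1}`,
  -- `‖w‖² - l ∫ w² ≥ (1 - l / λ_{k+m}) ‖w‖²`; this determines the constant `c`
  let L : LinkingData S.X0 :=
    { T := S.solOp
      N := hf.superGrad hg
      Φ := fun u => ∫ x in S.Ω, S.primitive f x (u x)
      I := S.J f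
      V := HSpace e (k - 1)
      W := PSpace e (k + m - 1)
      c := min (σ / lam (k - 1)) (σ / lam (k + m))
      α := lam (k - 1) + σ
      β := lam (k + m) - σ
      q := q
      r := q.conjExponent
      D := D
      c_pos := lt_min (div_pos hσ hk1) (div_pos hσ hkm)
      two_lt_q := hf.two_lt
      one_lt_r := hf.one_lt_conjExponent
      I_eq := J_eq f
      hasGradientAt := hf.hasGradientAt_J hgf hg
      T_symm := inner_solOp_comm
      orthogonal := fun v hv w hw => inner_eq_zero_of_mem (by omega) hv hw
      negative := fun l hl v hv => by
        have h1 := he.norm_sq_le_of_mem_HSpace hv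
        have h2 := inner_solOp_self_nonneg v
        have h3 : min (σ / lam (k - 1)) (σ / lam (k + m)) * ‖v‖ ^ 2 ≤
            σ / lam (k - 1) * (lam (k - 1) * inner ℝ (S.solOp v) v) :=
          mul_le_mul (min_le_left _ _) h1 (by positivity) (by positivity)
        rw [← mul_assoc, div_mul_cancel₀ _ hk1.ne'] at h3
        have h4 := mul_le_mul_of_nonneg_right hl.1 h2
        linarith
      positive := fun l hl w hw => by
        have h1 := he.mul_inner_solOp_le hw
        rw [hsucc] at h1
        have h2 := inner_solOp_self_nonneg w
        have h3 : min (σ / lam (k - 1)) (σ / lam (k + m)) * ‖w‖ ^ 2 ≤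
            σ / lam (k + m) * ‖w‖ ^ 2 := by
          gcongr
          exact min_le_right _ _
        have h4 := mul_le_mul_of_nonneg_right hl.2 h2
        have h5 : (lam (k + m) - σ) * inner ℝ (S.solOp w) w ≤ ‖w‖ ^ 2 - σ / lam (k + m) * ‖w‖ ^ 2 := by
          have h6 : 0 ≤ 1 - σ / lam (k + m) := by
            rw [sub_nonneg, div_le_one hkm]
            linarith [hl.1.trans hl.2]
          have h7 := mul_le_mul_of_nonneg_left h1 h6
          rw [← mul_assoc, sub_mul, div_mul_cancel₀ _ hkm.ne', one_mul] at h7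
          linarith
        linarith
      superquadratic := hf.superquadratic_le hgf hg
      Φ_zero := by
        have h1 := hf.superquadratic_le hgf hg 0
        rw [inner_zero_right] at h1
        have h2 := hf.integral_primitive_nonneg 0
        nlinarith [hf.two_lt]
      Φ_pos := fun u hu => hf.integral_primitive_pos hgf hg hu
      N_growth := hD
      N_small := fun ε hε => hf.exists_norm_superGrad_le hgf hg hε
      N_continuous := hf.continuous_superGrad hg
      compact := hf.exists_subseq_tendsto hg }
  obtain ⟨ε, hε, H⟩ := L.nablaCondition
  exact ⟨ε, hε, fun l hl ε' ε'' h1 _ h2 => H l hl ε' ε'' h1 h2⟩
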